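/- Let $f, g_1,\dots,g_m:\mathbb R^n\to\mathbb R$ be convex and continuously differentiable with locally Lipschitz gradients, let $A\in\mathbb R^{r\times n}$, $b\in\mathbb R^r$, and consider the problem of minimizing $f(x)$ subject to $g(x)\le 0$ and $Ax=b$, where $g=(g_1,\dots,g_m)$. Assume that the feasible set is nonempty and that $f$ attains a minimum on it. Write $\nabla g(x)\lambda=\sum_l\lambda_l\nabla g_l(x)$, let $\chi^*$ be the set of all $(x^*,\mu^*,\lambda^*)\in\mathbb R^n\times\mathbb R^r\times\mathbb R^m_{\ge0}$ with $$\nabla f(x^*)+\nabla g(x^*)\lambda^*+A^\top\mu^*=0,\quad Ax^*=b,\quad g(x^*)\le0,\quad \lambda^*_l\,g_l(x^*)=0\ \ (l=1,\dots,m),$$ and assume that $\chi^*\neq\emptyset$. For $i=1,\dots,n$, $j=1,\dots,r$, $l=1,\dots,m$ let $$M_i(s)=\frac{c_{i1}}{s}+\sum_{k=2}^{n_i}\frac{c_{ik}}{s+a_{ik}}+d_i,\qquad H_j(s)=\frac{\bar c_{j1}}{s}+\sum_{q=2}^{r_j}\frac{\bar c_{jq}}{s+\bar a_{jq}}+\bar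 d_j,$$ $$G_l^+(s)=\Big(\frac{\hat c_{l1}}{s}\Big)^++\sum_{p=2}^{m_l}\Big(\frac{\hat c_{lp}}{s+\hat a_{lp}}\Big)^++(\hat d_l)^+,$$ where $n_i,r_j,m_l\ge1$, all $c_{ik},\bar c_{jq},\hat c_{lp}$ are positive, $0<a_{i2}<\dots<a_{in_i}$, $0<\bar a_{j2}<\dots<\bar a_{jr_j}$, $0<\hat a_{l2}<\dots<\hat a_{lm_l}$, and $d_i,\bar d_j,\hat d_l\ge0$; put $a_{i1}=\bar a_{j1}=\hat a_{l1}=0$. The generalized primal-dual dynamics $x=M(s)v$, $\mu=H(s)h$, $\lambda=G^+(s)w$, with $M,H,G^+$ the diagonal matrices of these entries and $$v=-\nabla f(x)-\nabla g(x)\lambda-A^\top\mu,\qquad h=Ax-b,\qquad w=g(x),$$ is the system $$\dot\xi_{ik}=-a_{ik}\xi_{ik}+c_{ik}v_i,\qquad x_i=\sum_{k=1}^{n_i}\xi_{ik}+d_iv_i,$$ $$\dot\zeta_{jq}=-\bar a_{jq}\zeta_{jq}+\bar c_{jq}h_j,\qquad \mu_j=\sum_{q=1}^{r_j}\zeta_{jq}+\bar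 d_jh_j,$$ $$\dot\rho_{lp}=[-\hat a_{lp}\rho_{lp}+\hat c_{lp}w_l]^+_{\rho_{lp}},\qquad \lambda_l=\sum_{p=1}^{m_l}\rho_{lp}+\hat d_l\max\{0,w_l\},\qquad \rho_{lp}\ge0,$$ where $[\sigma]^+_\varepsilon=0$ if $\varepsilon=0$ and $\sigma<0$, and $[\sigma]^+_\varepsilon=\sigma$ otherwise. Solutions are understood in the sense of Carathéodory: the states $\xi,\zeta,\rho$ are locally absolutely continuous on $[0,\infty)$ and satisfy the differential equations at almost every time, while the output equations and $\rho\ge0$ hold at every time $t\ge0$. Assume that for every $i$ the transfer function $M_i$ has at least one stable zero, that is, a zero $s\in\mathbb C$ with $\operatorname{Re}s<0$. Then for every solution on $[0,\infty)$, whatever its initial state (with $\rho(0)\ge0$), there is a single point $(x^*,\mu^*,\lambda^*)\in\chi^*$ such that $(x(t),\mu(t),\lambda(t))\to(x^*,\mu^*,\lambda^*)$ as $t\to\infty$. No strict convexity of $f$ is assumed. -/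

import Mathlib

open scoped Matrix

/-- Data of the convex program: minimize `f x` subject to `g l x ≤ 0` for all `l` and `A x = b`. -/
structure ConvexProgram (n r m : ℕ) where
  f : EuclideanSpace ℝ (Fin n) → ℝ
  g : Fin m → EuclideanSpace ℝ (Fin n) → ℝ
  A : Matrix (Fin r) (Fin n) ℝ
  b : Fin r → ℝ

namespace ConvexProgram

variable {n r m : ℕ}

/-- The feasible set. -/
def feasibleSet (P : ConvexProgram n r m) : Set (EuclideanSpace ℝ (Fin n)) :=
  {x | (∀ l, P.g l x ≤ 0) ∧ P.A *ᵥ x.ofLp - P.b = 0}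

/-- The standing assumption: `f` and all `g l` are convex and continuously differentiable with
locally Lipschitz gradients, the feasible set is nonempty, and `f` attains a minimum on it. -/
structure StandingAssumption (P : ConvexProgram n r m) : Prop where
  convex_f : ConvexOn ℝ Set.univ P.f
  contDiff_f : ContDiff ℝ 1 P.f
  lipschitz_f : LocallyLipschitz (gradient P.f)
  convex_g : ∀ l, ConvexOn ℝ Set.univ (P.g l)
  contDiff_g : ∀ l, ContDiff ℝ 1 (P.g l)
  lipschitz_g : ∀ l, LocallyLipschitz (gradient (P.g l))
  feasible_nonempty : P.feasibleSet.Nonempty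
  exists_min : ∃ x ∈ P.feasibleSet, IsMinOn P.f P.feasibleSet x

/-- The signal `v = -∇f(x) - ∇g(x) lam - Aᵀ μ`. -/
noncomputable def signalV (P : ConvexProgram n r m) (x : EuclideanSpace ℝ (Fin n))
    (μ : Fin r → ℝ) (lam : Fin m → ℝ) (i : Fin n) : ℝ :=
  -(gradient P.f x i) - (∑ l, lam l * gradient (P.g l) x i) - (P.Aᵀ *ᵥ μ) i

/-- The signal `h = A x - b`. -/
def signalH (P : ConvexProgram n r m) (x : EuclideanSpace ℝ (Fin n)) (j : Fin r) : ℝ :=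
  (P.A *ᵥ x.ofLp) j - P.b j

/-- The signal `w = g(x)`. -/
def signalW (P : ConvexProgram n r m) (x : EuclideanSpace ℝ (Fin n)) (l : Fin m) : ℝ :=
  P.g l x

/-- The set of KKT triples `(x, μ, lam)`. -/
def kktSet (P : ConvexProgram n r m) :
    Set (EuclideanSpace ℝ (Fin n) × (Fin r → ℝ) × (Fin m → ℝ)) :=
  {z | (∀ i, gradient P.f z.1 i + (∑ l, z.2.2 l * gradient (P.g l) z.1 i)
          + (P.Aᵀ *ᵥ z.2.1) i = 0) ∧
       P.A *ᵥ z.1.ofLp - P.b = 0 ∧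
       (∀ l, 0 ≤ z.2.2 l) ∧ (∀ l, P.g l z.1 ≤ 0) ∧ (∀ l, z.2.2 l * P.g l z.1 = 0)}

end ConvexProgram

/-- The parameters of a scalar transfer function
`c 0 / s + ∑_{k = 1}^{p} c k / (s + a k) + d`: an integrator, `p` stable first-order lags with
distinct poles listed in order, and a feedthrough. The integrator is the term of index `0`, with
`a 0 = 0`; hence `0 < a 1 < ⋯ < a p`. -/
structure Channel where
  p : ℕ
  a : Fin (p + 1) → ℝ
  c : Fin (p + 1) → ℝ
  d : ℝ
  a_zero : a 0 = 0
  a_strictMono : StrictMono a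
  c_pos : ∀ k, 0 < c k
  d_nonneg : 0 ≤ d

namespace Channel

/-- The transfer function, as a function of the complex frequency away from the poles. -/
noncomputable def transfer (M : Channel) (s : ℂ) : ℂ :=
  (∑ k, (M.c k : ℂ) / (s + (M.a k : ℂ))) + (M.d : ℂ)

/-- The transfer function has a (finite) zero in the open left half-plane. The poles `-a k`, all of
which are genuine, are excluded. -/
def HasStableZero (M : Channel) : Prop :=
  ∃ s : ℂ, s.re < 0 ∧ (∀ k, s + (M.a k : ℂ) ≠ 0) ∧ M.transfer s = 0

end Channel

/-- The scalar operator `[σ]⁺_ε`: it is `0` if `ε = 0` and `σ < 0`, and `σ` otherwise. -/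
noncomputable def posProj (σ ε : ℝ) : ℝ :=
  if ε = 0 ∧ σ < 0 then 0 else σ

/-- `(x, μ, lam)` together with the states `(ξ, ζ, ρ)` is a Carathéodory solution on `[0, ∞)` of the
generalized primal-dual dynamics `x = M(s) v`, `μ = H(s) h`, `lam = G⁺(s) w`: the states are locally
absolutely continuous, satisfy the state equations at almost every time, `ρ` stays nonnegative, and
the output equations hold at every time. -/
structure IsPrimalDualTrajectory {n r m : ℕ} (P : ConvexProgram n r m)
    (M : Fin n → Channel) (H : Fin r → Channel) (G : Fin m → Channel)
    (ξ : (i : Fin n) → Fin ((M i).p + 1) → ℝ → ℝ)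
    (ζ : (j : Fin r) → Fin ((H j).p + 1) → ℝ → ℝ)
    (ρ : (l : Fin m) → Fin ((G l).p + 1) → ℝ → ℝ)
    (x : ℝ → EuclideanSpace ℝ (Fin n)) (μ : ℝ → Fin r → ℝ) (lam : ℝ → Fin m → ℝ) : Prop where
  ac_ξ : ∀ i k, ∀ T, 0 ≤ T → AbsolutelyContinuousOnInterval (ξ i k) 0 T
  ac_ζ : ∀ j q, ∀ T, 0 ≤ T → AbsolutelyContinuousOnInterval (ζ j q) 0 T
  ac_ρ : ∀ l p, ∀ T, 0 ≤ T → AbsolutelyContinuousOnInterval (ρ l p) 0 T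
  ρ_nonneg : ∀ l p, ∀ t, 0 ≤ t → 0 ≤ ρ l p t
  deriv_ξ : ∀ i k, ∀ᵐ t : ℝ, 0 < t →
    HasDerivAt (ξ i k)
      (-(M i).a k * ξ i k t + (M i).c k * P.signalV (x t) (μ t) (lam t) i) t
  deriv_ζ : ∀ j q, ∀ᵐ t : ℝ, 0 < t →
    HasDerivAt (ζ j q)
      (-(H j).a q * ζ j q t + (H j).c q * P.signalH (x t) j) t
  deriv_ρ : ∀ l p, ∀ᵐ t : ℝ, 0 < t →
    HasDerivAt (ρ l p)
      (posProj (-(G l).a p * ρ l p t + (G l).c p * P.signalW (x t) l) (ρ l p t)) t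
  output_x : ∀ t, 0 ≤ t → ∀ i,
    x t i = (∑ k, ξ i k t) + (M i).d * P.signalV (x t) (μ t) (lam t) i
  output_μ : ∀ t, 0 ≤ t → ∀ j,
    μ t j = (∑ q, ζ j q t) + (H j).d * P.signalH (x t) j
  output_lam : ∀ t, 0 ≤ t → ∀ l,
    lam t l = (∑ p, ρ l p t) + (G l).d * max 0 (P.signalW (x t) l)

/-!
Each scalar channel is a passive system. Measured from the equilibrium with output `y`, its storage
`∑ k, (z k - z* k) ^ 2 / (2 c k)` grows at most at the rate `(output - y) * input` minus a
dissipation, which collects `a k * z k ^ 2 / c k` from the lags and `d * input ^ 2` from the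
feedthrough (`Channel.hasDerivAt_storage_linear`, `Channel.exists_hasDerivAt_storage_projected`).
The channels are interconnected through the map `(x, μ, lam) ↦ (-v, -h, -w)`, which is monotone for
`lam ≥ 0` by convexity (`ConvexProgram.StandingAssumption.saddle_monotone`). Hence the sum of the
storages relative to any KKT point, the energy, is nonincreasing along trajectories
(`IsPrimalDualTrajectory.energy_derivGE`), and the states are bounded. Where there is feedthrough,
`x` is only given implicitly by an algebraic loop; the same monotonicity shows that the states
determine `x` and bound it, and by compactness `x` is uniformly continuous in time.

Barbalat's lemma then makes the total dissipation vanish at infinity. A channel `M i` with a stable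
zero has a lag or a feedthrough term; in the first case Barbalat's lemma applied to the lag, in the
second the dissipation itself, gives `v i → 0`
(`IsPrimalDualTrajectory.tendsto_inV`). This replaces strict convexity: `x` now varies slowly, that
is, its oscillation over windows of fixed length tends to `0`, and so do `h` and `w`. As the
integrators fed by `h` and `w` stay bounded over arbitrarily long windows, this forces `h → 0`,
`w⁺ → 0` and, looking at windows backwards in time, complementary slackness in the limit
(`IsPrimalDualTrajectory.tendsto_ρ_mul_signalW`).

So every limit point of the trajectory is the equilibrium of a KKT point `z`. The energy relative to
`z` is monotone and tends to `0` along a sequence of times, hence tends to `0`, and the outputs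
converge to `z`.
-/

open Filter Set Topology MeasureTheory

/-! ### Differential inequalities almost everywhere -/

/-- `u` is locally absolutely continuous on `[0, ∞)` and `u' ≥ φ` almost everywhere there. -/
def DerivGE (u φ : ℝ → ℝ) : Prop :=
  (∀ T, 0 ≤ T → AbsolutelyContinuousOnInterval u 0 T) ∧
    ∀ᵐ t : ℝ, 0 < t → ∃ D, HasDerivAt u D t ∧ φ t ≤ D

lemma DerivGE.of_hasDerivAt {u φ : ℝ → ℝ}
    (hu : ∀ T, 0 ≤ T → AbsolutelyContinuousOnInterval u 0 T)
    (hd : ∀ᵐ t : ℝ, 0 < t → HasDerivAt u (φ t) t) : DerivGE u φ :=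
  ⟨hu, hd.mono fun _ h h0 => ⟨_, h h0, le_rfl⟩⟩

lemma DerivGE.neg_of_hasDerivAt {u φ : ℝ → ℝ}
    (hu : ∀ T, 0 ≤ T → AbsolutelyContinuousOnInterval u 0 T)
    (hd : ∀ᵐ t : ℝ, 0 < t → HasDerivAt u (φ t) t) :
    DerivGE (fun t => -u t) (fun t => -φ t) :=
  ⟨fun T hT => (hu T hT).neg, hd.mono fun _ h h0 => ⟨_, (h h0).neg, le_rfl⟩⟩

lemma DerivGE.mul_le_sub {u φ : ℝ → ℝ} (h : DerivGE u φ) {a b K : ℝ} (ha : 0 ≤ a) (hab : a ≤ b)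
    (hK : ∀ t ∈ Ioo a b, K ≤ φ t) : K * (b - a) ≤ u b - u a := by
  have hac : AbsolutelyContinuousOnInterval u a b :=
    (h.1 b (ha.trans hab)).mono (by
      rw [uIcc_of_le hab, uIcc_of_le (ha.trans hab)]
      exact Icc_subset_Icc_left ha)
  rw [← hac.integral_deriv_eq_sub]
  have hne : ∀ᵐ t : ℝ, t ≠ b := by simp [ae_iff]
  have := intervalIntegral.integral_mono_ae_restrict hab
    (intervalIntegrable_const (μ := volume) (c := K)) hac.intervalIntegrable_deriv ?_
  · simpa [mul_comm] using this
  · rw [EventuallyLE, ae_restrict_iff' measurableSet_Icc]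
    have hna : ∀ᵐ t : ℝ, t ≠ a := by simp [ae_iff]
    filter_upwards [h.2, hne, hna] with t ht h1 h2 h3
    have h4 : t ∈ Ioo a b := ⟨lt_of_le_of_ne h3.1 h2.symm, lt_of_le_of_ne h3.2 h1⟩
    obtain ⟨D, hD, hle⟩ := ht (ha.trans_lt h4.1)
    rw [hD.deriv]
    exact (hK t h4).trans hle

/-- If `φ` cannot drop by more than `ε / 2` over windows of length `T`, and `u` with `u' ≥ φ`
cannot increase by `T ε / 2` over such windows, then eventually `φ ≤ ε`. -/
lemma DerivGE.eventually_le_of_window {u φ : ℝ → ℝ} (h : DerivGE u φ) {ε T : ℝ} (hT : 0 < T)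
    (hφ : ∀ᶠ t in atTop, ∀ s ∈ Icc t (t + T), φ t - ε / 2 ≤ φ s)
    (hu : ∀ᶠ t in atTop, u (t + T) - u t < T * (ε / 2)) :
    ∀ᶠ t in atTop, φ t ≤ ε := by
  filter_upwards [hφ, hu, eventually_ge_atTop 0] with t h1 h2 h3
  by_contra! hlt
  have := h.mul_le_sub (K := ε / 2) h3 (by linarith : t ≤ t + T)
    (fun s hs => by have := h1 s ⟨hs.1.le, hs.2.le⟩; linarith)
  nlinarith

/-- One-sided Barbalat lemma. -/
lemma DerivGE.eventually_le_of_uniformContinuousOn {u φ : ℝ → ℝ} (h : DerivGE u φ) {L : ℝ}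
    (hu : Tendsto u atTop (𝓝 L)) (hφ : UniformContinuousOn φ (Ici 0)) {ε : ℝ} (hε : 0 < ε) :
    ∀ᶠ t in atTop, φ t ≤ ε := by
  obtain ⟨δ, hδ, hd⟩ := Metric.uniformContinuousOn_iff.1 hφ (ε / 2) (by positivity)
  refine h.eventually_le_of_window (T := δ / 2) (by positivity) ?_ ?_
  · filter_upwards [eventually_ge_atTop 0] with t ht s hs
    have := hd t ht s (ht.trans hs.1) (by
      rw [Real.dist_eq, abs_lt]; constructor <;> linarith [hs.1, hs.2])
    rw [Real.dist_eq, abs_lt] at this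
    linarith
  · have : Tendsto (fun t => u (t + δ / 2) - u t) atTop (𝓝 (L - L)) :=
      (hu.comp (tendsto_atTop_add_const_right _ _ tendsto_id)).sub hu
    rw [sub_self] at this
    exact this.eventually_lt_const (by positivity)

/-- Barbalat's lemma: a uniformly continuous derivative of a convergent function vanishes at
infinity. -/
lemma tendsto_zero_of_hasDerivAt_of_uniformContinuousOn {u φ : ℝ → ℝ}
    (hac : ∀ T, 0 ≤ T → AbsolutelyContinuousOnInterval u 0 T)
    (hd : ∀ᵐ t : ℝ, 0 < t → HasDerivAt u (φ t) t) {L : ℝ}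
    (hu : Tendsto u atTop (𝓝 L)) (hφ : UniformContinuousOn φ (Ici 0)) :
    Tendsto φ atTop (𝓝 0) := by
  rw [Metric.tendsto_nhds]
  intro ε hε
  filter_upwards [(DerivGE.of_hasDerivAt hac hd).eventually_le_of_uniformContinuousOn hu hφ
      (half_pos hε),
    (DerivGE.neg_of_hasDerivAt hac hd).eventually_le_of_uniformContinuousOn hu.neg
      (uniformContinuous_neg.comp_uniformContinuousOn hφ)
      (half_pos hε)] with t h1 h2
  rw [Real.dist_eq, sub_zero, abs_lt]
  constructor <;> linarith

/-! ### Slow variation at infinity -/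

/-- The oscillation of `f` over windows of any fixed length vanishes at infinity. -/
def SlowlyVarying {E : Type*} [PseudoMetricSpace E] (f : ℝ → E) : Prop :=
  ∀ T ε : ℝ, 0 < ε → ∀ᶠ t in atTop, ∀ s ∈ Icc t (t + T), dist (f s) (f t) ≤ ε

lemma SlowlyVarying.congr {E : Type*} [PseudoMetricSpace E] {f g : ℝ → E}
    (hf : SlowlyVarying f) (h : ∀ t, 0 ≤ t → f t = g t) : SlowlyVarying g := by
  intro T ε hε
  filter_upwards [hf T ε hε, eventually_ge_atTop 0] with t ht h0 s hs
  rw [← h t h0, ← h s (h0.trans hs.1)]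
  exact ht s hs

lemma SlowlyVarying.of_tendsto {E : Type*} [PseudoMetricSpace E] {f : ℝ → E} {L : E}
    (hf : Tendsto f atTop (𝓝 L)) : SlowlyVarying f := by
  intro T ε hε
  obtain ⟨N, hN⟩ := eventually_atTop.1 (Metric.tendsto_nhds.1 hf (ε / 2) (half_pos hε))
  filter_upwards [eventually_ge_atTop N] with t ht s hs
  have := dist_triangle_right (f s) (f t) L
  linarith [hN t ht, hN s (ht.trans hs.1)]

/-- A function whose derivative vanishes at infinity varies slowly. -/
lemma SlowlyVarying.of_hasDerivAt {u φ : ℝ → ℝ}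
    (hac : ∀ T, 0 ≤ T → AbsolutelyContinuousOnInterval u 0 T)
    (hd : ∀ᵐ t : ℝ, 0 < t → HasDerivAt u (φ t) t) (hφ : Tendsto φ atTop (𝓝 0)) :
    SlowlyVarying u := by
  intro T ε hε
  have hpos : 0 < ε / (|T| + 1) := by positivity
  obtain ⟨N, hN⟩ := eventually_atTop.1 (Metric.tendsto_nhds.1 hφ _ hpos)
  filter_upwards [eventually_ge_atTop N, eventually_ge_atTop 0] with t ht h0 s hs
  have hb : ∀ τ ∈ Ioo t s, |φ τ| < ε / (|T| + 1) := fun τ hτ => by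
    simpa [Real.dist_eq] using hN τ (ht.trans hτ.1.le)
  have h1 := (DerivGE.of_hasDerivAt hac hd).mul_le_sub (K := -(ε / (|T| + 1))) h0 hs.1
    (fun τ hτ => (abs_lt.1 (hb τ hτ)).1.le)
  have h2 := (DerivGE.neg_of_hasDerivAt hac hd).mul_le_sub (K := -(ε / (|T| + 1))) h0 hs.1
    (fun τ hτ => by linarith [(abs_lt.1 (hb τ hτ)).2])
  have h3 : ε / (|T| + 1) * (s - t) ≤ ε := by
    rw [div_mul_eq_mul_div, div_le_iff₀ (by positivity)]
    exact mul_le_mul_of_nonneg_left (by linarith [hs.2, le_abs_self T]) hε.le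
  rw [Real.dist_eq, abs_le]
  constructor <;> linarith

lemma SlowlyVarying.add {f g : ℝ → ℝ} (hf : SlowlyVarying f) (hg : SlowlyVarying g) :
    SlowlyVarying (fun t => f t + g t) := by
  intro T ε hε
  filter_upwards [hf T _ (half_pos hε), hg T _ (half_pos hε)] with t h1 h2 s hs
  exact (dist_add_add_le _ _ _ _).trans (by linarith [h1 s hs, h2 s hs])

lemma SlowlyVarying.sum {ι : Type*} {S : Finset ι} {f : ι → ℝ → ℝ}
    (hf : ∀ i ∈ S, SlowlyVarying (f i)) : SlowlyVarying (fun t => ∑ i ∈ S, f i t) := by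
  classical
  induction S using Finset.induction_on with
  | empty => simpa using SlowlyVarying.of_tendsto (tendsto_const_nhds (x := (0 : ℝ)))
  | insert i S hi ih =>
    simp only [Finset.sum_insert hi]
    exact (hf i (by simp)).add (ih fun j hj => hf j (by simp [hj]))

lemma SlowlyVarying.euclidean {n : ℕ} {f : ℝ → EuclideanSpace ℝ (Fin n)}
    (hf : ∀ i, SlowlyVarying (fun t => f t i)) : SlowlyVarying f := by
  intro T ε hε
  have hpos : 0 < ε / (n + 1) := by positivity
  filter_upwards [eventually_all.2 fun i => hf i T _ hpos] with t ht s hs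
  rw [EuclideanSpace.dist_eq]
  refine Real.sqrt_le_iff.2 ⟨hε.le, ?_⟩
  calc ∑ i, dist (f s i) (f t i) ^ 2 ≤ ∑ _i : Fin n, (ε / (n + 1)) ^ 2 :=
        Finset.sum_le_sum fun i _ => pow_le_pow_left₀ dist_nonneg (ht i s hs) 2
    _ = n * ε ^ 2 / (n + 1) ^ 2 := by simp [div_pow, mul_div_assoc]
    _ ≤ ε ^ 2 := by
      rw [div_le_iff₀ (by positivity)]
      have hn : (0 : ℝ) ≤ n := n.cast_nonneg
      nlinarith [mul_nonneg hn (sq_nonneg ε), mul_nonneg (mul_nonneg hn hn) (sq_nonneg ε)]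

/-- `f` is bounded on `[0, ∞)`. -/
def BoundedOnNonneg {E : Type*} [PseudoMetricSpace E] (f : ℝ → E) : Prop :=
  Bornology.IsBounded (f '' Ici 0)

lemma BoundedOnNonneg.exists_isCompact {E : Type*} [PseudoMetricSpace E] [ProperSpace E]
    {f : ℝ → E} (hf : BoundedOnNonneg f) : ∃ K, IsCompact K ∧ ∀ t, 0 ≤ t → f t ∈ K :=
  ⟨_, hf.isCompact_closure, fun t ht => subset_closure ⟨t, ht, rfl⟩⟩

lemma boundedOnNonneg_real {f : ℝ → ℝ} : BoundedOnNonneg f ↔ ∃ C, ∀ t, 0 ≤ t → |f t| ≤ C := by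
  simp [BoundedOnNonneg, isBounded_iff_forall_norm_le]

lemma BoundedOnNonneg.comp {E F : Type*} [PseudoMetricSpace E] [ProperSpace E]
    [PseudoMetricSpace F] {f : ℝ → E} (hf : BoundedOnNonneg f) {g : E → F} (hg : Continuous g) :
    BoundedOnNonneg (fun t => g (f t)) := by
  obtain ⟨K, hK, hm⟩ := hf.exists_isCompact
  exact (hK.image hg).isBounded.subset (by rintro _ ⟨t, ht, rfl⟩; exact ⟨_, hm t ht, rfl⟩)

lemma BoundedOnNonneg.pi {ι : Type*} [Fintype ι] {E : ι → Type*} [∀ i, PseudoMetricSpace (E i)]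
    {f : ℝ → ∀ i, E i} (hf : ∀ i, BoundedOnNonneg (fun t => f t i)) : BoundedOnNonneg f :=
  (Bornology.IsBounded.pi hf).subset
    (by rintro _ ⟨t, ht, rfl⟩ i _; exact ⟨t, ht, rfl⟩)

lemma BoundedOnNonneg.prodMk {E F : Type*} [PseudoMetricSpace E] [PseudoMetricSpace F]
    {f : ℝ → E} {g : ℝ → F} (hf : BoundedOnNonneg f) (hg : BoundedOnNonneg g) :
    BoundedOnNonneg (fun t => (f t, g t)) :=
  (Bornology.IsBounded.prod hf hg).subset
    (by rintro _ ⟨t, ht, rfl⟩; exact ⟨⟨t, ht, rfl⟩, ⟨t, ht, rfl⟩⟩)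

lemma SlowlyVarying.comp {E F : Type*} [PseudoMetricSpace E] [ProperSpace E]
    [PseudoMetricSpace F] {f : ℝ → E} (hf : SlowlyVarying f) (hb : BoundedOnNonneg f) {g : E → F}
    (hg : Continuous g) : SlowlyVarying (fun t => g (f t)) := by
  obtain ⟨K, hK, hm⟩ := hb.exists_isCompact
  intro T ε hε
  obtain ⟨δ, hδ, hd⟩ := Metric.uniformContinuousOn_iff.1
    (hK.uniformContinuousOn_of_continuous hg.continuousOn) ε hε
  filter_upwards [hf T _ (half_pos hδ), eventually_ge_atTop 0] with t ht h0 s hs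
  exact (hd _ (hm s (h0.trans hs.1)) _ (hm t h0) ((ht s hs).trans_lt (half_lt_self hδ))).le

lemma UniformContinuousOn.comp_of_boundedOnNonneg {E F : Type*} [PseudoMetricSpace E]
    [ProperSpace E] [PseudoMetricSpace F] {f : ℝ → E} (hf : UniformContinuousOn f (Ici 0))
    (hb : BoundedOnNonneg f) {g : E → F} (hg : Continuous g) :
    UniformContinuousOn (fun t => g (f t)) (Ici 0) := by
  obtain ⟨K, hK, hm⟩ := hb.exists_isCompact
  exact (hK.uniformContinuousOn_of_continuous hg.continuousOn).comp hf fun t ht => hm t ht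

lemma uniformContinuousOn_pi {ι α : Type*} [UniformSpace α] {S : Set α} {E : ι → Type*}
    [∀ i, UniformSpace (E i)] {f : α → ∀ i, E i}
    (hf : ∀ i, UniformContinuousOn (fun t => f t i) S) : UniformContinuousOn f S := by
  rw [uniformContinuousOn_iff_restrict, uniformContinuous_pi]
  exact fun i => uniformContinuousOn_iff_restrict.1 (hf i)

lemma uniformContinuousOn_prodMk {α E F : Type*} [UniformSpace α] [UniformSpace E]
    [UniformSpace F] {S : Set α} {f : α → E} {g : α → F} (hf : UniformContinuousOn f S)
    (hg : UniformContinuousOn g S) : UniformContinuousOn (fun t => (f t, g t)) S :=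
  uniformContinuousOn_iff_restrict.2
    ((uniformContinuousOn_iff_restrict.1 hf).prodMk (uniformContinuousOn_iff_restrict.1 hg))

/-- If `u` is bounded and `u' ≥ φ` with `φ` slowly varying, then `limsup φ ≤ 0`. -/
lemma DerivGE.eventually_le_of_slowlyVarying {u φ : ℝ → ℝ} (h : DerivGE u φ)
    (hu : BoundedOnNonneg u) (hφ : SlowlyVarying φ) {ε : ℝ} (hε : 0 < ε) :
    ∀ᶠ t in atTop, φ t ≤ ε := by
  obtain ⟨C, hC⟩ := boundedOnNonneg_real.1 hu
  have hC0 : 0 ≤ C := (abs_nonneg _).trans (hC 0 le_rfl)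
  have hT : 0 < (2 * C + 1) / (ε / 2) := by positivity
  -- Over this window, growth at rate `ε / 2` exceeds the oscillation `2 * C` of `u`.
  refine h.eventually_le_of_window (T := (2 * C + 1) / (ε / 2)) hT ?_ ?_
  · filter_upwards [hφ ((2 * C + 1) / (ε / 2)) _ (half_pos hε)] with t ht s hs
    have := ht s hs
    rw [Real.dist_eq, abs_le] at this
    linarith
  · filter_upwards [eventually_ge_atTop 0] with t ht
    rw [div_mul_cancel₀ _ (by positivity)]
    have h1 := abs_le.1 (hC t ht)
    have h2 := abs_le.1 (hC (t + (2 * C + 1) / (ε / 2)) (by linarith))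
    linarith

/-- A bounded derivative almost everywhere gives uniform continuity. -/
lemma uniformContinuousOn_of_ae_hasDerivAt_bounded {u : ℝ → ℝ} {C : ℝ}
    (hac : ∀ T, 0 ≤ T → AbsolutelyContinuousOnInterval u 0 T)
    (hd : ∀ᵐ t : ℝ, 0 < t → ∃ D, HasDerivAt u D t ∧ |D| ≤ C) :
    UniformContinuousOn u (Ici 0) := by
  have h1 : DerivGE u (fun _ => -C) :=
    ⟨hac, hd.mono fun t h h0 => by
      obtain ⟨D, hD, hC⟩ := h h0
      exact ⟨D, hD, (abs_le.1 hC).1⟩⟩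
  have h2 : DerivGE (fun t => -u t) (fun _ => -C) :=
    ⟨fun T hT => (hac T hT).neg, hd.mono fun t h h0 => by
      obtain ⟨D, hD, hC⟩ := h h0
      exact ⟨-D, hD.neg, neg_le_neg (abs_le.1 hC).2⟩⟩
  have key : ∀ s t : ℝ, 0 ≤ s → s ≤ t → |u t - u s| ≤ C * (t - s) := by
    intro s t hs hst
    have := h1.mul_le_sub (K := -C) hs hst (fun _ _ => le_rfl)
    have := h2.mul_le_sub (K := -C) hs hst (fun _ _ => le_rfl)
    rw [abs_le]; constructor <;> linarith
  have hC : 0 ≤ C := by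
    have := (abs_nonneg _).trans (key 0 1 le_rfl zero_le_one)
    linarith
  have : LipschitzOnWith C.toNNReal u (Ici 0) := by
    refine LipschitzOnWith.of_dist_le_mul fun s hs t ht => ?_
    rw [Real.coe_toNNReal _ hC, Real.dist_eq, Real.dist_eq]
    rcases le_total s t with h | h
    · rw [abs_sub_comm, abs_sub_comm s t, abs_of_nonneg (sub_nonneg.2 h)]
      exact key s t hs h
    · rw [abs_of_nonneg (sub_nonneg.2 h)]
      exact key t s ht h
  exact this.uniformContinuousOn

/-- On a compact set on which the first coordinate determines the second, it does so uniformly. -/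
lemma IsCompact.exists_dist_lt_of_fst_determines {E F : Type*} [MetricSpace E] [MetricSpace F]
    {K : Set (E × F)} (hK : IsCompact K)
    (hinj : ∀ p ∈ K, ∀ q ∈ K, p.1 = q.1 → p.2 = q.2) {ε : ℝ} (hε : 0 < ε) :
    ∃ δ > 0, ∀ p ∈ K, ∀ q ∈ K, dist p.1 q.1 < δ → dist p.2 q.2 < ε := by
  have hS : IsCompact ((K ×ˢ K) ∩ {z | ε ≤ dist z.1.2 z.2.2}) :=
    (hK.prod hK).inter_right (isClosed_le continuous_const (by fun_prop))
  rcases Set.eq_empty_or_nonempty ((K ×ˢ K) ∩ {z | ε ≤ dist z.1.2 z.2.2}) with h0 | hne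
  · refine ⟨1, one_pos, fun p hp q hq _ => ?_⟩
    by_contra! h
    have : (p, q) ∈ ((K ×ˢ K) ∩ {z | ε ≤ dist z.1.2 z.2.2}) := ⟨⟨hp, hq⟩, h⟩
    simp [h0] at this
  · obtain ⟨z, hz, hmin⟩ := hS.exists_isMinOn hne
      (f := fun z : (E × F) × (E × F) => dist z.1.1 z.2.1) (by fun_prop)
    refine ⟨dist z.1.1 z.2.1, dist_pos.2 fun h => ?_, fun p hp q hq hlt => ?_⟩
    · have := hinj _ hz.1.1 _ hz.1.2 h
      have h2 : ε ≤ dist z.1.2 z.2.2 := hz.2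
      rw [this, dist_self] at h2
      linarith
    · by_contra! h
      exact absurd (isMinOn_iff.1 hmin (p, q) ⟨⟨hp, hq⟩, h⟩) (not_le.2 hlt)

/-- A bounded curve in a closed set on which the first coordinate determines the second is
uniformly continuous as soon as its first coordinate is. -/
lemma UniformContinuousOn.of_fst_determines {E F : Type*} [MetricSpace E] [MetricSpace F]
    [ProperSpace E] [ProperSpace F] {f : ℝ → E} {g : ℝ → F} {S : Set (E × F)}
    (hf : UniformContinuousOn f (Ici 0)) (hb : BoundedOnNonneg fun t => (f t, g t))
    (hS : IsClosed S) (hinj : ∀ p ∈ S, ∀ q ∈ S, p.1 = q.1 → p.2 = q.2)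
    (hmem : ∀ t, 0 ≤ t → (f t, g t) ∈ S) : UniformContinuousOn g (Ici 0) := by
  obtain ⟨K, hK, hm⟩ := hb.exists_isCompact
  rw [Metric.uniformContinuousOn_iff] at hf ⊢
  intro ε hε
  obtain ⟨δ, hδ, hd⟩ := (hK.inter_right hS).exists_dist_lt_of_fst_determines
    (fun p hp q hq h => hinj p hp.2 q hq.2 h) hε
  obtain ⟨δ', hδ', hd'⟩ := hf δ hδ
  exact ⟨δ', hδ', fun s hs t ht hst =>
    hd _ ⟨hm s hs, hmem s hs⟩ _ ⟨hm t ht, hmem t ht⟩ (hd' s hs t ht hst)⟩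

/-! ### Monotonicity of the saddle operator -/

/-- The tangent plane of a convex function lies below its graph. -/
lemma ConvexOn.sum_gradient_mul_sub_le {n : ℕ} {f : EuclideanSpace ℝ (Fin n) → ℝ}
    (hf : ConvexOn ℝ univ f) (hd : Differentiable ℝ f) (x y : EuclideanSpace ℝ (Fin n)) :
    ∑ i, gradient f x i * (y i - x i) ≤ f y - f x := by
  have hg : HasFDerivAt f (InnerProductSpace.toDual ℝ _ (gradient f x)) x :=
    (hd x).hasGradientAt.hasFDerivAt
  have hl : HasDerivAt (fun t : ℝ => AffineMap.lineMap x y t) (y - x) 0 := by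
    simpa using AffineMap.hasDerivAt_lineMap (a := x) (b := y) (x := (0 : ℝ))
  have hφ : HasDerivAt (fun t : ℝ => f (AffineMap.lineMap x y t))
      (InnerProductSpace.toDual ℝ _ (gradient f x) (y - x)) 0 :=
    HasFDerivAt.comp_hasDerivAt (0 : ℝ) (by simpa using hg) hl
  have hc : ConvexOn ℝ univ (fun t : ℝ => f (AffineMap.lineMap x y t)) := by
    exact hf.comp_affineMap (AffineMap.lineMap x y : ℝ →ᵃ[ℝ] EuclideanSpace ℝ (Fin n))
  have := hc.le_slope_of_hasDerivAt (mem_univ 0) (mem_univ 1) one_pos hφ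
  rw [InnerProductSpace.toDual_apply_apply, PiLp.inner_apply] at this
  simpa [slope_def_field, mul_comm] using this

namespace ConvexProgram

variable {n r m : ℕ} {P : ConvexProgram n r m}

lemma sum_mul_transpose_mulVec (P : ConvexProgram n r m) (x x' : EuclideanSpace ℝ (Fin n))
    (μ : Fin r → ℝ) :
    ∑ i, (x i - x' i) * (P.Aᵀ *ᵥ μ) i = ∑ j, μ j * (P.signalH x j - P.signalH x' j) := by
  have h1 : (x.ofLp - x'.ofLp) ⬝ᵥ (P.Aᵀ *ᵥ μ) = μ ⬝ᵥ (P.A *ᵥ (x.ofLp - x'.ofLp)) := by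
    rw [Matrix.dotProduct_mulVec, Matrix.vecMul_transpose, dotProduct_comm]
  simpa [dotProduct, Matrix.mulVec_sub, signalH] using h1

/-- The map `(x, μ, lam) ↦ (-v, -h, -w)` is monotone on `lam ≥ 0`. -/
lemma StandingAssumption.saddle_monotone (hP : P.StandingAssumption)
    (x x' : EuclideanSpace ℝ (Fin n)) (μ μ' : Fin r → ℝ) {lam lam' : Fin m → ℝ}
    (hl : ∀ l, 0 ≤ lam l) (hl' : ∀ l, 0 ≤ lam' l) :
    ∑ i, (x i - x' i) * (P.signalV x μ lam i - P.signalV x' μ' lam' i)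
      + ∑ j, (μ j - μ' j) * (P.signalH x j - P.signalH x' j)
      + ∑ l, (lam l - lam' l) * (P.signalW x l - P.signalW x' l) ≤ 0 := by
  have hf := hP.convex_f.sum_gradient_mul_sub_le (hP.contDiff_f.differentiable one_ne_zero)
  have hg := fun l =>
    (hP.convex_g l).sum_gradient_mul_sub_le ((hP.contDiff_g l).differentiable one_ne_zero)
  have hF : ∑ i, (x i - x' i) * (gradient P.f x' i - gradient P.f x i) ≤ 0 := by
    have h1 := hf x x'
    have h2 := hf x' x
    have : ∑ i, (x i - x' i) * (gradient P.f x' i - gradient P.f x i)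
        = ∑ i, gradient P.f x i * (x' i - x i) + ∑ i, gradient P.f x' i * (x i - x' i) := by
      rw [← Finset.sum_add_distrib]
      exact Finset.sum_congr rfl fun i _ => by ring
    linarith
  have hG : ∑ i, (x i - x' i) * (∑ l, lam' l * gradient (P.g l) x' i
        - ∑ l, lam l * gradient (P.g l) x i)
      + ∑ l, (lam l - lam' l) * (P.signalW x l - P.signalW x' l) ≤ 0 := by
    have : ∑ i, (x i - x' i) * (∑ l, lam' l * gradient (P.g l) x' i
        - ∑ l, lam l * gradient (P.g l) x i)
        = ∑ l, (lam l * ∑ i, gradient (P.g l) x i * (x' i - x i)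
          + lam' l * ∑ i, gradient (P.g l) x' i * (x i - x' i)) := by
      simp_rw [← Finset.sum_sub_distrib, Finset.mul_sum, ← Finset.sum_add_distrib]
      rw [Finset.sum_comm]
      exact Finset.sum_congr rfl fun l _ => Finset.sum_congr rfl fun i _ => by ring
    rw [this, ← Finset.sum_add_distrib]
    refine Finset.sum_nonpos fun l _ => ?_
    have h1 := mul_le_mul_of_nonneg_left (hg l x x') (hl l)
    have h2 := mul_le_mul_of_nonneg_left (hg l x' x) (hl' l)
    simp only [signalW]
    linarith
  have hA : ∑ i, (x i - x' i) * ((P.Aᵀ *ᵥ μ') i - (P.Aᵀ *ᵥ μ) i)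
      + ∑ j, (μ j - μ' j) * (P.signalH x j - P.signalH x' j) = 0 := by
    simp_rw [mul_sub (_ - _) ((P.Aᵀ *ᵥ μ') _), Finset.sum_sub_distrib, P.sum_mul_transpose_mulVec,
      sub_mul (μ _), Finset.sum_sub_distrib]
    ring
  have hV : ∑ i, (x i - x' i) * (P.signalV x μ lam i - P.signalV x' μ' lam' i)
      = ∑ i, (x i - x' i) * (gradient P.f x' i - gradient P.f x i)
        + ∑ i, (x i - x' i) * (∑ l, lam' l * gradient (P.g l) x' i
          - ∑ l, lam l * gradient (P.g l) x i)
        + ∑ i, (x i - x' i) * ((P.Aᵀ *ᵥ μ') i - (P.Aᵀ *ᵥ μ) i) := by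
    simp_rw [← Finset.sum_add_distrib]
    exact Finset.sum_congr rfl fun i _ => by simp only [signalV]; ring
  linarith

lemma mem_kktSet_iff {z : EuclideanSpace ℝ (Fin n) × (Fin r → ℝ) × (Fin m → ℝ)} :
    z ∈ P.kktSet ↔ (∀ i, P.signalV z.1 z.2.1 z.2.2 i = 0) ∧ (∀ j, P.signalH z.1 j = 0) ∧
      (∀ l, 0 ≤ z.2.2 l) ∧ (∀ l, P.signalW z.1 l ≤ 0) ∧
      (∀ l, z.2.2 l * P.signalW z.1 l = 0) := by
  have h1 : ∀ i, (P.signalV z.1 z.2.1 z.2.2 i = 0 ↔ gradient P.f z.1 i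
      + (∑ l, z.2.2 l * gradient (P.g l) z.1 i) + (P.Aᵀ *ᵥ z.2.1) i = 0) := fun i => by
    rw [signalV]; constructor <;> intro h <;> linarith
  have h2 : (∀ j, P.signalH z.1 j = 0) ↔ P.A *ᵥ z.1.ofLp - P.b = 0 := by
    simp [funext_iff, signalH]
  simp only [kktSet, mem_ofPred_eq, h1, h2, signalW]

/-- The supply rate of the interconnection is nonpositive relative to a KKT point. -/
lemma StandingAssumption.supply_nonpos (hP : P.StandingAssumption)
    {z : EuclideanSpace ℝ (Fin n) × (Fin r → ℝ) × (Fin m → ℝ)} (hz : z ∈ P.kktSet)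
    (x : EuclideanSpace ℝ (Fin n)) (μ : Fin r → ℝ) {lam : Fin m → ℝ} (hl : ∀ l, 0 ≤ lam l) :
    ∑ i, (x i - z.1 i) * P.signalV x μ lam i + ∑ j, (μ j - z.2.1 j) * P.signalH x j
      + ∑ l, (lam l - z.2.2 l) * P.signalW x l ≤ 0 := by
  obtain ⟨hv, hh, hlz, hw, hc⟩ := mem_kktSet_iff.1 hz
  have h := hP.saddle_monotone x z.1 μ z.2.1 hl hlz
  simp only [hv, hh, sub_zero] at h
  have : ∑ l, (lam l - z.2.2 l) * P.signalW x l
      ≤ ∑ l, (lam l - z.2.2 l) * (P.signalW x l - P.signalW z.1 l) :=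
    Finset.sum_le_sum fun l _ => by nlinarith [hc l, mul_nonpos_of_nonneg_of_nonpos (hl l) (hw l)]
  linarith

lemma continuous_signalH (P : ConvexProgram n r m) : Continuous P.signalH := by
  unfold signalH
  fun_prop

lemma StandingAssumption.continuous_signalW (hP : P.StandingAssumption) :
    Continuous P.signalW :=
  continuous_pi fun l => (hP.contDiff_g l).continuous

lemma StandingAssumption.continuous_signalV (hP : P.StandingAssumption) :
    Continuous (fun q : EuclideanSpace ℝ (Fin n) × (Fin r → ℝ) × (Fin m → ℝ) =>
      P.signalV q.1 q.2.1 q.2.2) := by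
  have hf := hP.lipschitz_f.continuous
  have hg := fun l => (hP.lipschitz_g l).continuous
  unfold signalV
  fun_prop

end ConvexProgram

/-! ### Storage functions of the channels -/

lemma self_le_posProj (σ ε : ℝ) : σ ≤ posProj σ ε := by
  unfold posProj
  split_ifs with h
  · exact h.2.le
  · rfl

lemma abs_posProj_le (σ ε : ℝ) : |posProj σ ε| ≤ |σ| := by
  unfold posProj
  split_ifs with h
  · simp
  · rfl

lemma mul_posProj_le {y ε σ : ℝ} (hy : 0 ≤ y) : (ε - y) * posProj σ ε ≤ (ε - y) * σ := by
  unfold posProj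
  split_ifs with h
  · rw [h.1]; nlinarith [h.2]
  · rfl

lemma AbsolutelyContinuousOnInterval.finset_sum {ι : Type*} {S : Finset ι}
    {f : ι → ℝ → ℝ} {a b : ℝ} (hf : ∀ i ∈ S, AbsolutelyContinuousOnInterval (f i) a b) :
    AbsolutelyContinuousOnInterval (fun t => ∑ i ∈ S, f i t) a b := by
  classical
  induction S using Finset.induction_on with
  | empty =>
    simpa using (LipschitzWith.const (α := ℝ) (0 : ℝ)).lipschitzOnWith
      (s := uIcc a b) |>.absolutelyContinuousOnInterval
  | insert i S hi ih =>
    simp only [Finset.sum_insert hi]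
    exact (hf i (by simp)).add (ih fun j hj => hf j (by simp [hj]))

namespace Channel

/-- A transfer function with a stable zero is not a pure integrator. -/
lemma HasStableZero.exists_ne_zero_or_pos {M : Channel} (h : M.HasStableZero) :
    (∃ k : Fin (M.p + 1), k ≠ 0) ∨ 0 < M.d := by
  by_contra! hc
  obtain ⟨s, -, hs, h0⟩ := h
  have hd : M.d = 0 := le_antisymm hc.2 M.d_nonneg
  have huniv : (Finset.univ : Finset (Fin (M.p + 1))) = {0} :=
    Finset.eq_singleton_iff_unique_mem.2 ⟨Finset.mem_univ _, fun k _ => hc.1 k⟩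
  rw [transfer, huniv, Finset.sum_singleton, hd, Complex.ofReal_zero, add_zero,
    div_eq_zero_iff] at h0
  rcases h0 with h0 | h0
  · exact (M.c_pos 0).ne' (by exact_mod_cast h0)
  · exact hs 0 h0

lemma a_nonneg (M : Channel) (k : Fin (M.p + 1)) : 0 ≤ M.a k :=
  M.a_zero ▸ M.a_strictMono.monotone (Fin.zero_le k)

lemma a_pos (M : Channel) {k : Fin (M.p + 1)} (hk : k ≠ 0) : 0 < M.a k :=
  M.a_zero ▸ M.a_strictMono (Fin.pos_iff_ne_zero.2 hk)

/-- The storage function of a channel relative to the equilibrium with output `y`, at which the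
integrator state is `y` and all other states vanish. -/
noncomputable def storage (M : Channel) (y : ℝ) (z : Fin (M.p + 1) → ℝ) : ℝ :=
  ∑ k, (z k - if k = 0 then y else 0) ^ 2 / (2 * M.c k)

/-- The power dissipated in a channel by its lags (state `z`) and its feedthrough (input `u`). -/
noncomputable def dissipation (M : Channel) (z : Fin (M.p + 1) → ℝ) (u : ℝ) : ℝ :=
  ∑ k, M.a k * z k ^ 2 / M.c k + M.d * u ^ 2

variable (M : Channel)

lemma storage_nonneg (y : ℝ) (z : Fin (M.p + 1) → ℝ) : 0 ≤ M.storage y z :=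
  Finset.sum_nonneg fun k _ => div_nonneg (sq_nonneg _) (by have := M.c_pos k; positivity)

lemma sq_le_storage (y : ℝ) (z : Fin (M.p + 1) → ℝ) (k : Fin (M.p + 1)) :
    (z k - if k = 0 then y else 0) ^ 2 / (2 * M.c k) ≤ M.storage y z :=
  Finset.single_le_sum (f := fun k => (z k - if k = 0 then y else 0) ^ 2 / (2 * M.c k))
    (fun k _ => div_nonneg (sq_nonneg _) (by have := M.c_pos k; positivity)) (Finset.mem_univ k)

lemma continuous_storage (y : ℝ) : Continuous (M.storage y) := by
  unfold storage
  fun_prop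

lemma continuous_dissipation :
    Continuous (fun q : (Fin (M.p + 1) → ℝ) × ℝ => M.dissipation q.1 q.2) := by
  unfold dissipation
  fun_prop

lemma lag_nonneg (z : Fin (M.p + 1) → ℝ) (k : Fin (M.p + 1)) : 0 ≤ M.a k * z k ^ 2 / M.c k :=
  div_nonneg (mul_nonneg (M.a_nonneg k) (sq_nonneg _)) (M.c_pos k).le

lemma dissipation_nonneg (z : Fin (M.p + 1) → ℝ) (u : ℝ) : 0 ≤ M.dissipation z u :=
  add_nonneg (Finset.sum_nonneg fun k _ => M.lag_nonneg z k) (mul_nonneg M.d_nonneg (sq_nonneg _))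

lemma lag_le_dissipation (z : Fin (M.p + 1) → ℝ) (u : ℝ) (k : Fin (M.p + 1)) :
    M.a k * z k ^ 2 / M.c k ≤ M.dissipation z u :=
  (Finset.single_le_sum (f := fun k => M.a k * z k ^ 2 / M.c k)
    (fun k _ => M.lag_nonneg z k) (Finset.mem_univ k)).trans
    (le_add_of_nonneg_right (mul_nonneg M.d_nonneg (sq_nonneg _)))

lemma feedthrough_le_dissipation (z : Fin (M.p + 1) → ℝ) (u : ℝ) :
    M.d * u ^ 2 ≤ M.dissipation z u :=
  le_add_of_nonneg_left (Finset.sum_nonneg fun k _ => M.lag_nonneg z k)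

lemma hasDerivAt_storage {z : Fin (M.p + 1) → ℝ → ℝ} {D : Fin (M.p + 1) → ℝ} {t : ℝ} (y : ℝ)
    (hz : ∀ k, HasDerivAt (z k) (D k) t) :
    HasDerivAt (fun t => M.storage y (fun k => z k t))
      (∑ k, (z k t - if k = 0 then y else 0) * D k / M.c k) t := by
  unfold storage
  refine HasDerivAt.fun_sum fun k _ => ?_
  refine ((((hz k).sub_const (if k = 0 then y else 0)).fun_pow 2).div_const
    (2 * M.c k)).congr_deriv ?_
  have := (M.c_pos k).ne'
  field_simp
  ring

lemma sum_sub_mul_linear (y : ℝ) (z : Fin (M.p + 1) → ℝ) (u : ℝ) :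
    ∑ k, (z k - if k = 0 then y else 0) * (-M.a k * z k + M.c k * u) / M.c k
      = (∑ k, z k - y) * u - ∑ k, M.a k * z k ^ 2 / M.c k := by
  have hy : y = ∑ k : Fin (M.p + 1), if k = 0 then y else 0 := by simp
  have h : (∑ k, z k - y) * u = ∑ k, (z k - if k = 0 then y else 0) * u := by
    rw [← Finset.sum_mul, Finset.sum_sub_distrib, ← hy]
  rw [h, ← Finset.sum_sub_distrib]
  refine Finset.sum_congr rfl fun k _ => ?_
  have := (M.c_pos k).ne'
  split_ifs with hk
  · subst hk
    rw [M.a_zero]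
    field_simp
    ring
  · field_simp
    ring

/-- Dissipation equality of a linear channel with output `∑ k, z k + d u`. -/
lemma hasDerivAt_storage_linear {z : Fin (M.p + 1) → ℝ → ℝ} {u t : ℝ} (y : ℝ)
    (hz : ∀ k, HasDerivAt (z k) (-M.a k * z k t + M.c k * u) t) :
    HasDerivAt (fun t => M.storage y (fun k => z k t))
      ((∑ k, z k t + M.d * u - y) * u - M.dissipation (fun k => z k t) u) t := by
  refine (M.hasDerivAt_storage y hz).congr_deriv ?_
  rw [M.sum_sub_mul_linear, dissipation]
  ring

/-- Dissipation inequality of a projected channel with output `∑ k, z k + d u⁺`. -/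
lemma exists_hasDerivAt_storage_projected {z : Fin (M.p + 1) → ℝ → ℝ} {u t y : ℝ} (hy : 0 ≤ y)
    (hz : ∀ k, HasDerivAt (z k) (posProj (-M.a k * z k t + M.c k * u) (z k t)) t) :
    ∃ D, HasDerivAt (fun t => M.storage y (fun k => z k t)) D t ∧
      D ≤ (∑ k, z k t + M.d * max 0 u - y) * u
        - M.dissipation (fun k => z k t) (max 0 u) := by
  refine ⟨_, M.hasDerivAt_storage y hz, ?_⟩
  have h1 : ∑ k, (z k t - if k = 0 then y else 0)
        * posProj (-M.a k * z k t + M.c k * u) (z k t) / M.c k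
      ≤ ∑ k, (z k t - if k = 0 then y else 0) * (-M.a k * z k t + M.c k * u) / M.c k :=
    Finset.sum_le_sum fun k _ => by
      refine div_le_div_of_nonneg_right (mul_posProj_le ?_) (M.c_pos k).le
      split_ifs <;> simp [hy]
  refine h1.trans_eq ?_
  rw [M.sum_sub_mul_linear (z := fun k => z k t), dissipation]
  have : max 0 u * u = max 0 u ^ 2 := by
    rcases le_total 0 u with h | h <;> simp [h, sq]
  linear_combination M.d * (-this)

lemma absolutelyContinuousOnInterval_storage {z : Fin (M.p + 1) → ℝ → ℝ} {a b : ℝ} (y : ℝ)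
    (hz : ∀ k, AbsolutelyContinuousOnInterval (z k) a b) :
    AbsolutelyContinuousOnInterval (fun t => M.storage y (fun k => z k t)) a b := by
  unfold storage
  refine AbsolutelyContinuousOnInterval.finset_sum fun k _ => ?_
  have hc : AbsolutelyContinuousOnInterval (fun _ : ℝ => if k = 0 then y else 0) a b :=
    ((LipschitzWith.const (α := ℝ) (if k = 0 then y else 0)).lipschitzOnWith
      (s := uIcc a b)).absolutelyContinuousOnInterval
  have h := (hz k).sub hc
  have := (h.mul h).const_mul (1 / (2 * M.c k))
  refine (congrArg (fun f => AbsolutelyContinuousOnInterval f a b) (funext fun t => ?_)).mp this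
  simp only [Pi.sub_apply, Pi.mul_apply]
  ring

end Channel

/-! ### The algebraic loop -/

section Network

variable {n r m : ℕ} {P : ConvexProgram n r m} {M : Fin n → Channel} {H : Fin r → Channel}
  {G : Fin m → Channel}

/-- The states `(ξ, ζ, ρ)` of all channels. -/
abbrev NetState (M : Fin n → Channel) (H : Fin r → Channel) (G : Fin m → Channel) : Type :=
  ((i : Fin n) → Fin ((M i).p + 1) → ℝ) × ((j : Fin r) → Fin ((H j).p + 1) → ℝ) ×
    ((l : Fin m) → Fin ((G l).p + 1) → ℝ)

namespace NetState

/-- The multiplier `μ` as a function of the states and of `x`. -/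
def outMu (P : ConvexProgram n r m) (y : NetState M H G) (x : EuclideanSpace ℝ (Fin n)) :
    Fin r → ℝ :=
  fun j => ∑ q, y.2.1 j q + (H j).d * P.signalH x j

/-- The multiplier `lam` as a function of the states and of `x`. -/
noncomputable def outLam (P : ConvexProgram n r m) (y : NetState M H G)
    (x : EuclideanSpace ℝ (Fin n)) : Fin m → ℝ :=
  fun l => ∑ p, y.2.2 l p + (G l).d * max 0 (P.signalW x l)

/-- The signal `v` as a function of the states and of `x`. -/
noncomputable def inV (P : ConvexProgram n r m) (y : NetState M H G)
    (x : EuclideanSpace ℝ (Fin n)) : Fin n → ℝ :=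
  P.signalV x (y.outMu P x) (y.outLam P x)

/-- The part of `x` contributed by the states. -/
noncomputable def stateSum (y : NetState M H G) : EuclideanSpace ℝ (Fin n) :=
  WithLp.toLp 2 fun i => ∑ k, y.1 i k

/-- `x` solves the algebraic loop `x = ∑ k, ξ k + d v` closed by the feedthrough terms. -/
def SolvesLoop (P : ConvexProgram n r m) (y : NetState M H G) (x : EuclideanSpace ℝ (Fin n)) :
    Prop :=
  ∀ i, x i = ∑ k, y.1 i k + (M i).d * y.inV P x i

lemma outLam_nonneg {y : NetState M H G} (hy : ∀ l p, 0 ≤ y.2.2 l p)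
    (x : EuclideanSpace ℝ (Fin n)) (l : Fin m) : 0 ≤ y.outLam P x l :=
  add_nonneg (Finset.sum_nonneg fun p _ => hy l p)
    (mul_nonneg (G l).d_nonneg (le_max_left _ _))

lemma continuous_outMu :
    Continuous (fun q : NetState M H G × EuclideanSpace ℝ (Fin n) => q.1.outMu P q.2) := by
  have := P.continuous_signalH
  unfold outMu
  fun_prop

lemma continuous_outLam (hP : P.StandingAssumption) :
    Continuous (fun q : NetState M H G × EuclideanSpace ℝ (Fin n) => q.1.outLam P q.2) := by
  have := hP.continuous_signalW
  unfold outLam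
  fun_prop

lemma continuous_inV (hP : P.StandingAssumption) :
    Continuous (fun q : NetState M H G × EuclideanSpace ℝ (Fin n) => q.1.inV P q.2) :=
  hP.continuous_signalV.comp
    (continuous_snd.prodMk (continuous_outMu.prodMk (continuous_outLam hP)))

lemma continuous_stateSum :
    Continuous (fun y : NetState M H G => y.stateSum) := by
  unfold stateSum
  fun_prop

/-- The algebraic loop is monotone: with the states frozen, `x ↦ -v` is a monotone map. -/
lemma sum_mul_inV_sub_nonpos (hP : P.StandingAssumption) {y : NetState M H G}
    (hy : ∀ l p, 0 ≤ y.2.2 l p) (x x' : EuclideanSpace ℝ (Fin n)) :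
    ∑ i, (x i - x' i) * (y.inV P x i - y.inV P x' i) ≤ 0 := by
  have h := hP.saddle_monotone x x' (y.outMu P x) (y.outMu P x')
    (outLam_nonneg (P := P) hy x) (outLam_nonneg (P := P) hy x')
  have h1 : 0 ≤ ∑ j, (y.outMu P x j - y.outMu P x' j) * (P.signalH x j - P.signalH x' j) :=
    Finset.sum_nonneg fun j _ => by
      have : (y.outMu P x j - y.outMu P x' j) * (P.signalH x j - P.signalH x' j)
          = (H j).d * (P.signalH x j - P.signalH x' j) ^ 2 := by
        simp only [outMu]; ring
      rw [this]
      exact mul_nonneg (H j).d_nonneg (sq_nonneg _)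
  have h2 : 0 ≤ ∑ l, (y.outLam P x l - y.outLam P x' l) * (P.signalW x l - P.signalW x' l) :=
    Finset.sum_nonneg fun l _ => by
      have : (y.outLam P x l - y.outLam P x' l) * (P.signalW x l - P.signalW x' l)
          = (G l).d * ((max 0 (P.signalW x l) - max 0 (P.signalW x' l))
            * (P.signalW x l - P.signalW x' l)) := by
        simp only [outLam]; ring
      rw [this]
      refine mul_nonneg (G l).d_nonneg ?_
      rcases le_total (P.signalW x l) (P.signalW x' l) with h | h
      · exact mul_nonneg_of_nonpos_of_nonpos (sub_nonpos.2 (max_le_max_left 0 h))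
          (sub_nonpos.2 h)
      · exact mul_nonneg (sub_nonneg.2 (max_le_max_left 0 h)) (sub_nonneg.2 h)
  simp only [inV]
  linarith

/-- The states determine the solution of the algebraic loop. -/
lemma SolvesLoop.unique (hP : P.StandingAssumption) {y : NetState M H G}
    (hy : ∀ l p, 0 ≤ y.2.2 l p) {x x' : EuclideanSpace ℝ (Fin n)} (hx : y.SolvesLoop P x)
    (hx' : y.SolvesLoop P x') : x = x' := by
  have h := sum_mul_inV_sub_nonpos hP hy x x'
  have he : ∀ i, (x i - x' i) * (y.inV P x i - y.inV P x' i)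
      = (M i).d * (y.inV P x i - y.inV P x' i) ^ 2 := fun i => by
    rw [hx i, hx' i]; ring
  have hnn : ∀ i ∈ Finset.univ, 0 ≤ (x i - x' i) * (y.inV P x i - y.inV P x' i) := fun i _ => by
    rw [he]; exact mul_nonneg (M i).d_nonneg (sq_nonneg _)
  have h0 := (Finset.sum_eq_zero_iff_of_nonneg hnn).1 (le_antisymm h (Finset.sum_nonneg hnn))
  ext i
  have h1 := h0 i (Finset.mem_univ i)
  rw [he] at h1
  have h2 : (M i).d * (y.inV P x i - y.inV P x' i) = 0 := by
    rcases mul_eq_zero.1 h1 with h | h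
    · rw [h, zero_mul]
    · rw [pow_eq_zero_iff two_ne_zero] at h
      rw [h, mul_zero]
  have h3 := hx i
  have h4 := hx' i
  linarith

/-- The pairs of a state with `ρ ≥ 0` and a solution `x` of its algebraic loop. -/
def loopGraph (P : ConvexProgram n r m) (M : Fin n → Channel) (H : Fin r → Channel)
    (G : Fin m → Channel) : Set (NetState M H G × EuclideanSpace ℝ (Fin n)) :=
  {w | (∀ l p, 0 ≤ w.1.2.2 l p) ∧ w.1.SolvesLoop P w.2}

lemma loopGraph_fst_determines (hP : P.StandingAssumption)
    {w w' : NetState M H G × EuclideanSpace ℝ (Fin n)} (hw : w ∈ loopGraph P M H G)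
    (hw' : w' ∈ loopGraph P M H G) (h : w.1 = w'.1) : w.2 = w'.2 := by
  obtain ⟨y, x⟩ := w
  obtain ⟨y', x'⟩ := w'
  obtain rfl : y = y' := h
  exact SolvesLoop.unique hP hw.1 hw.2 hw'.2

lemma isClosed_loopGraph (hP : P.StandingAssumption) : IsClosed (loopGraph P M H G) := by
  have hV := continuous_pi_iff.1 (continuous_inV (M := M) (H := H) (G := G) hP)
  have h1 : IsClosed {w : NetState M H G × EuclideanSpace ℝ (Fin n) |
      ∀ l p, 0 ≤ w.1.2.2 l p} := by
    simp only [ofPred_forall]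
    exact isClosed_iInter fun l => isClosed_iInter fun p =>
      isClosed_le continuous_const (by fun_prop)
  have h2 : IsClosed {w : NetState M H G × EuclideanSpace ℝ (Fin n) | w.1.SolvesLoop P w.2} := by
    simp only [SolvesLoop, ofPred_forall]
    exact isClosed_iInter fun i => isClosed_eq (by fun_prop) (by have := hV i; fun_prop)
  exact h1.inter h2

/-- Comparison of the solution of the algebraic loop with `stateSum` bounds the feedthrough terms
by a function of the states alone. -/
lemma SolvesLoop.feedthrough_le (hP : P.StandingAssumption) {y : NetState M H G}
    (hy : ∀ l p, 0 ≤ y.2.2 l p) {x : EuclideanSpace ℝ (Fin n)} (hx : y.SolvesLoop P x)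
    (i : Fin n) :
    (M i).d * y.inV P x i ^ 2 ≤ ∑ i, (M i).d * y.inV P y.stateSum i ^ 2 := by
  have h := sum_mul_inV_sub_nonpos hP hy x y.stateSum
  have h1 : ∑ i, ((M i).d * y.inV P x i ^ 2 - (M i).d * y.inV P y.stateSum i ^ 2) / 2
      ≤ ∑ i, (x i - y.stateSum i) * (y.inV P x i - y.inV P y.stateSum i) :=
    Finset.sum_le_sum fun i _ => by
      have : x i - y.stateSum i = (M i).d * y.inV P x i := by rw [hx i]; simp [stateSum]
      rw [this]
      nlinarith [mul_nonneg (M i).d_nonneg (sq_nonneg (y.inV P x i - y.inV P y.stateSum i))]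
  rw [← Finset.sum_div, Finset.sum_sub_distrib] at h1
  have h2 := Finset.single_le_sum (f := fun i => (M i).d * y.inV P x i ^ 2)
    (fun i _ => mul_nonneg (M i).d_nonneg (sq_nonneg _)) (Finset.mem_univ i)
  linarith

/-- The total storage relative to the equilibrium with output `z`. -/
noncomputable def energy (z : EuclideanSpace ℝ (Fin n) × (Fin r → ℝ) × (Fin m → ℝ))
    (y : NetState M H G) : ℝ :=
  ∑ i, (M i).storage (z.1 i) (y.1 i) + ∑ j, (H j).storage (z.2.1 j) (y.2.1 j)
    + ∑ l, (G l).storage (z.2.2 l) (y.2.2 l)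

/-- The total dissipated power. -/
noncomputable def totalDissipation (P : ConvexProgram n r m) (y : NetState M H G)
    (x : EuclideanSpace ℝ (Fin n)) : ℝ :=
  ∑ i, (M i).dissipation (y.1 i) (y.inV P x i)
    + ∑ j, (H j).dissipation (y.2.1 j) (P.signalH x j)
    + ∑ l, (G l).dissipation (y.2.2 l) (max 0 (P.signalW x l))

variable (z : EuclideanSpace ℝ (Fin n) × (Fin r → ℝ) × (Fin m → ℝ)) (y : NetState M H G)
  (x : EuclideanSpace ℝ (Fin n))

lemma continuous_energy : Continuous (energy z : NetState M H G → ℝ) := by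
  have h1 := fun i => (M i).continuous_storage (z.1 i)
  have h2 := fun j => (H j).continuous_storage (z.2.1 j)
  have h3 := fun l => (G l).continuous_storage (z.2.2 l)
  unfold energy
  fun_prop

lemma continuous_totalDissipation (hP : P.StandingAssumption) :
    Continuous (fun q : NetState M H G × EuclideanSpace ℝ (Fin n) =>
      q.1.totalDissipation P q.2) := by
  have hV := continuous_pi_iff.1 (continuous_inV (M := M) (H := H) (G := G) hP)
  have hW := hP.continuous_signalW
  have hH := P.continuous_signalH
  unfold totalDissipation
  refine ((continuous_finsetSum _ fun i _ => ?_).add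
    (continuous_finsetSum _ fun j _ => ?_)).add (continuous_finsetSum _ fun l _ => ?_)
  · exact (M i).continuous_dissipation.comp
      (((continuous_apply i).comp (continuous_fst.comp continuous_fst)).prodMk (hV i))
  · exact (H j).continuous_dissipation.comp
      (f := fun q : NetState M H G × EuclideanSpace ℝ (Fin n) => (q.1.2.1 j, P.signalH q.2 j))
      (by fun_prop)
  · exact (G l).continuous_dissipation.comp
      (f := fun q : NetState M H G × EuclideanSpace ℝ (Fin n) =>
        (q.1.2.2 l, max 0 (P.signalW q.2 l)))
      (by fun_prop)

lemma primal_storage_nonneg : 0 ≤ ∑ i, (M i).storage (z.1 i) (y.1 i) :=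
  Finset.sum_nonneg fun i _ => (M i).storage_nonneg _ _

lemma equality_storage_nonneg : 0 ≤ ∑ j, (H j).storage (z.2.1 j) (y.2.1 j) :=
  Finset.sum_nonneg fun j _ => (H j).storage_nonneg _ _

lemma inequality_storage_nonneg : 0 ≤ ∑ l, (G l).storage (z.2.2 l) (y.2.2 l) :=
  Finset.sum_nonneg fun l _ => (G l).storage_nonneg _ _

lemma energy_nonneg : 0 ≤ energy z y :=
  add_nonneg (add_nonneg (primal_storage_nonneg z y) (equality_storage_nonneg z y))
    (inequality_storage_nonneg z y)

lemma primal_storage_le_energy (i : Fin n) : (M i).storage (z.1 i) (y.1 i) ≤ energy z y := by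
  have h := Finset.single_le_sum (f := fun i => (M i).storage (z.1 i) (y.1 i))
    (fun i _ => (M i).storage_nonneg _ _) (Finset.mem_univ i)
  simp only [energy] at h ⊢
  linarith [equality_storage_nonneg z y, inequality_storage_nonneg z y]

lemma equality_storage_le_energy (j : Fin r) :
    (H j).storage (z.2.1 j) (y.2.1 j) ≤ energy z y := by
  have h := Finset.single_le_sum (f := fun j => (H j).storage (z.2.1 j) (y.2.1 j))
    (fun j _ => (H j).storage_nonneg _ _) (Finset.mem_univ j)
  simp only [energy] at h ⊢
  linarith [primal_storage_nonneg z y, inequality_storage_nonneg z y]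

lemma inequality_storage_le_energy (l : Fin m) :
    (G l).storage (z.2.2 l) (y.2.2 l) ≤ energy z y := by
  have h := Finset.single_le_sum (f := fun l => (G l).storage (z.2.2 l) (y.2.2 l))
    (fun l _ => (G l).storage_nonneg _ _) (Finset.mem_univ l)
  simp only [energy] at h ⊢
  linarith [primal_storage_nonneg z y, equality_storage_nonneg z y]

lemma primal_dissipation_nonneg : 0 ≤ ∑ i, (M i).dissipation (y.1 i) (y.inV P x i) :=
  Finset.sum_nonneg fun i _ => (M i).dissipation_nonneg _ _

lemma equality_dissipation_nonneg : 0 ≤ ∑ j, (H j).dissipation (y.2.1 j) (P.signalH x j) :=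
  Finset.sum_nonneg fun j _ => (H j).dissipation_nonneg _ _

lemma inequality_dissipation_nonneg :
    0 ≤ ∑ l, (G l).dissipation (y.2.2 l) (max 0 (P.signalW x l)) :=
  Finset.sum_nonneg fun l _ => (G l).dissipation_nonneg _ _

lemma totalDissipation_nonneg : 0 ≤ y.totalDissipation P x :=
  add_nonneg (add_nonneg (primal_dissipation_nonneg y x) (equality_dissipation_nonneg y x))
    (inequality_dissipation_nonneg y x)

lemma primal_dissipation_le (i : Fin n) :
    (M i).dissipation (y.1 i) (y.inV P x i) ≤ y.totalDissipation P x := by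
  have h := Finset.single_le_sum (f := fun i => (M i).dissipation (y.1 i) (y.inV P x i))
    (fun i _ => (M i).dissipation_nonneg _ _) (Finset.mem_univ i)
  simp only [totalDissipation] at h ⊢
  linarith [equality_dissipation_nonneg (P := P) y x, inequality_dissipation_nonneg (P := P) y x]

lemma equality_dissipation_le (j : Fin r) :
    (H j).dissipation (y.2.1 j) (P.signalH x j) ≤ y.totalDissipation P x := by
  have h := Finset.single_le_sum (f := fun j => (H j).dissipation (y.2.1 j) (P.signalH x j))
    (fun j _ => (H j).dissipation_nonneg _ _) (Finset.mem_univ j)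
  simp only [totalDissipation] at h ⊢
  linarith [primal_dissipation_nonneg (P := P) y x, inequality_dissipation_nonneg (P := P) y x]

lemma inequality_dissipation_le (l : Fin m) :
    (G l).dissipation (y.2.2 l) (max 0 (P.signalW x l)) ≤ y.totalDissipation P x := by
  have h := Finset.single_le_sum
    (f := fun l => (G l).dissipation (y.2.2 l) (max 0 (P.signalW x l)))
    (fun l _ => (G l).dissipation_nonneg _ _) (Finset.mem_univ l)
  simp only [totalDissipation] at h ⊢
  linarith [primal_dissipation_nonneg (P := P) y x, equality_dissipation_nonneg (P := P) y x]

end NetState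

end Network

/-- A component of a channel state is bounded when the storage is. -/
lemma Channel.boundedOnNonneg_of_storage_le {M : Channel} {y C : ℝ} {z : Fin (M.p + 1) → ℝ → ℝ}
    (h : ∀ t, 0 ≤ t → M.storage y (fun k => z k t) ≤ C) (k : Fin (M.p + 1)) :
    BoundedOnNonneg (z k) := by
  refine boundedOnNonneg_real.2 ⟨2 * M.c k * C + 1 + |y|, fun t ht => ?_⟩
  have h1 := (M.sq_le_storage y (fun k => z k t) k).trans (h t ht)
  have hc := M.c_pos k
  rw [div_le_iff₀ (by positivity)] at h1
  have h2 : |z k t - if k = 0 then y else 0| ≤ 2 * M.c k * C + 1 := by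
    nlinarith [sq_abs (z k t - if k = 0 then y else 0),
      sq_nonneg (|z k t - if k = 0 then y else 0| - 1)]
  have h3 : |if k = 0 then y else 0| ≤ |y| := by split_ifs <;> simp
  have := abs_add_le (z k t - if k = 0 then y else 0) (if k = 0 then y else 0)
  rw [sub_add_cancel] at this
  linarith

/-- A channel state converges to the equilibrium relative to which the storage vanishes at
infinity. -/
lemma Channel.tendsto_of_tendsto_storage {M : Channel} {y : ℝ} {z : Fin (M.p + 1) → ℝ → ℝ}
    (h : Tendsto (fun t => M.storage y (fun k => z k t)) atTop (𝓝 0)) (k : Fin (M.p + 1)) :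
    Tendsto (z k) atTop (𝓝 (if k = 0 then y else 0)) := by
  have hc := M.c_pos k
  have h1 : Tendsto (fun t => (z k t - if k = 0 then y else 0) ^ 2 / (2 * M.c k)) atTop (𝓝 0) :=
    squeeze_zero (fun t => by positivity) (fun t => M.sq_le_storage y (fun k => z k t) k) h
  have h2 := (h1.mul_const (2 * M.c k)).sqrt
  simp only [div_mul_cancel₀ _ (show 2 * M.c k ≠ 0 by positivity), Real.sqrt_sq_eq_abs, zero_mul,
    Real.sqrt_zero] at h2
  rw [tendsto_iff_dist_tendsto_zero]
  simpa only [Real.dist_eq] using h2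

lemma tendsto_zero_of_mul_sq_le {f φ : ℝ → ℝ} {c : ℝ} (hc : 0 < c)
    (h : ∀ t, c * f t ^ 2 ≤ φ t) (hφ : Tendsto φ atTop (𝓝 0)) : Tendsto f atTop (𝓝 0) := by
  have h1 : Tendsto (fun t => c * f t ^ 2) atTop (𝓝 0) :=
    squeeze_zero (fun t => by positivity) h hφ
  have h2 := (h1.div_const c).sqrt
  simp only [mul_div_cancel_left₀ _ hc.ne', Real.sqrt_sq_eq_abs, zero_div, Real.sqrt_zero] at h2
  exact (tendsto_zero_iff_abs_tendsto_zero f).2 h2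

/-! ### Boundedness and uniform continuity of trajectories -/

namespace IsPrimalDualTrajectory

variable {n r m : ℕ} {P : ConvexProgram n r m} {M : Fin n → Channel} {H : Fin r → Channel}
  {G : Fin m → Channel} {ξ : (i : Fin n) → Fin ((M i).p + 1) → ℝ → ℝ}
  {ζ : (j : Fin r) → Fin ((H j).p + 1) → ℝ → ℝ} {ρ : (l : Fin m) → Fin ((G l).p + 1) → ℝ → ℝ}
  {x : ℝ → EuclideanSpace ℝ (Fin n)} {μ : ℝ → Fin r → ℝ} {lam : ℝ → Fin m → ℝ}

/-- The joint state at time `t`. -/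
def state (ξ : (i : Fin n) → Fin ((M i).p + 1) → ℝ → ℝ)
    (ζ : (j : Fin r) → Fin ((H j).p + 1) → ℝ → ℝ) (ρ : (l : Fin m) → Fin ((G l).p + 1) → ℝ → ℝ)
    (t : ℝ) : NetState M H G :=
  (fun i k => ξ i k t, fun j q => ζ j q t, fun l p => ρ l p t)

open NetState

lemma mu_eq (hs : IsPrimalDualTrajectory P M H G ξ ζ ρ x μ lam) {t : ℝ} (ht : 0 ≤ t) :
    μ t = (state ξ ζ ρ t).outMu P (x t) :=
  funext fun j => hs.output_μ t ht j

lemma lam_eq (hs : IsPrimalDualTrajectory P M H G ξ ζ ρ x μ lam) {t : ℝ} (ht : 0 ≤ t) :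
    lam t = (state ξ ζ ρ t).outLam P (x t) :=
  funext fun l => hs.output_lam t ht l

lemma signalV_eq (hs : IsPrimalDualTrajectory P M H G ξ ζ ρ x μ lam) {t : ℝ} (ht : 0 ≤ t) :
    P.signalV (x t) (μ t) (lam t) = (state ξ ζ ρ t).inV P (x t) := by
  rw [hs.mu_eq ht, hs.lam_eq ht, inV]

lemma state_nonneg (hs : IsPrimalDualTrajectory P M H G ξ ζ ρ x μ lam) {t : ℝ} (ht : 0 ≤ t) :
    ∀ l p, 0 ≤ (state ξ ζ ρ t).2.2 l p :=
  fun l p => hs.ρ_nonneg l p t ht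

lemma solvesLoop (hs : IsPrimalDualTrajectory P M H G ξ ζ ρ x μ lam) {t : ℝ} (ht : 0 ≤ t) :
    (state ξ ζ ρ t).SolvesLoop P (x t) := fun i => by
  rw [hs.output_x t ht i, hs.signalV_eq ht]
  rfl

lemma hasDerivAt_ξ (hs : IsPrimalDualTrajectory P M H G ξ ζ ρ x μ lam) (i : Fin n)
    (k : Fin ((M i).p + 1)) :
    ∀ᵐ t : ℝ, 0 < t → HasDerivAt (ξ i k)
      (-(M i).a k * ξ i k t + (M i).c k * (state ξ ζ ρ t).inV P (x t) i) t := by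
  filter_upwards [hs.deriv_ξ i k] with t ht h0
  rw [← hs.signalV_eq h0.le]
  exact ht h0

/-- The energy relative to a KKT point decreases at least at the rate of dissipation. -/
lemma energy_derivGE (hs : IsPrimalDualTrajectory P M H G ξ ζ ρ x μ lam)
    (hP : P.StandingAssumption) {z : EuclideanSpace ℝ (Fin n) × (Fin r → ℝ) × (Fin m → ℝ)}
    (hz : z ∈ P.kktSet) :
    DerivGE (fun t => -energy z (state ξ ζ ρ t))
      (fun t => (state ξ ζ ρ t).totalDissipation P (x t)) := by
  constructor
  · intro T hT
    refine AbsolutelyContinuousOnInterval.neg (f := fun t => energy z (state ξ ζ ρ t)) ?_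
    exact ((AbsolutelyContinuousOnInterval.finset_sum fun i _ =>
        (M i).absolutelyContinuousOnInterval_storage _ fun k => hs.ac_ξ i k T hT).add
      (AbsolutelyContinuousOnInterval.finset_sum fun j _ =>
        (H j).absolutelyContinuousOnInterval_storage _ fun q => hs.ac_ζ j q T hT)).add
      (AbsolutelyContinuousOnInterval.finset_sum fun l _ =>
        (G l).absolutelyContinuousOnInterval_storage _ fun p => hs.ac_ρ l p T hT)
  · have h1 := ae_all_iff.2 fun i => ae_all_iff.2 fun k => hs.hasDerivAt_ξ i k
    have h2 := ae_all_iff.2 fun j => ae_all_iff.2 fun q => hs.deriv_ζ j q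
    have h3 := ae_all_iff.2 fun l => ae_all_iff.2 fun p => hs.deriv_ρ l p
    filter_upwards [h1, h2, h3] with t ht1 ht2 ht3 h0
    have hz0 : ∀ l, 0 ≤ z.2.2 l := (ConvexProgram.mem_kktSet_iff.1 hz).2.2.1
    choose D hD hle using fun l =>
      (G l).exists_hasDerivAt_storage_projected (hz0 l) fun p => ht3 l p h0
    have hd := ((HasDerivAt.fun_sum (u := Finset.univ) fun i _ =>
        (M i).hasDerivAt_storage_linear (z.1 i) fun k => ht1 i k h0).add
      (HasDerivAt.fun_sum (u := Finset.univ) fun j _ =>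
        (H j).hasDerivAt_storage_linear (z.2.1 j) fun q => ht2 j q h0)).add
      (HasDerivAt.fun_sum (u := Finset.univ) fun l _ => hD l)
    refine ⟨_, hd.neg, ?_⟩
    have hs3 := Finset.sum_le_sum fun l (_ : l ∈ Finset.univ) => hle l
    have hsup := hP.supply_nonpos hz (x t) ((state ξ ζ ρ t).outMu P (x t))
      (outLam_nonneg (P := P) (hs.state_nonneg h0.le) (x t))
    have e1 : ∑ i, (x t i - z.1 i)
          * P.signalV (x t) ((state ξ ζ ρ t).outMu P (x t)) ((state ξ ζ ρ t).outLam P (x t)) i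
        = ∑ i, (∑ k, ξ i k t + (M i).d * (state ξ ζ ρ t).inV P (x t) i - z.1 i)
          * (state ξ ζ ρ t).inV P (x t) i :=
      Finset.sum_congr rfl fun i _ => by rw [hs.solvesLoop h0.le i]; rfl
    rw [e1] at hsup
    simp only [Finset.sum_sub_distrib] at hs3 ⊢
    simp only [outMu, outLam, state, totalDissipation] at hsup hs3 ⊢
    linarith

lemma energy_antitoneOn (hs : IsPrimalDualTrajectory P M H G ξ ζ ρ x μ lam)
    (hP : P.StandingAssumption) {z : EuclideanSpace ℝ (Fin n) × (Fin r → ℝ) × (Fin m → ℝ)}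
    (hz : z ∈ P.kktSet) : AntitoneOn (fun t => energy z (state ξ ζ ρ t)) (Ici 0) := by
  intro a ha b _ hab
  have := (hs.energy_derivGE hP hz).mul_le_sub (K := 0) ha hab
    fun t _ => totalDissipation_nonneg _ _
  simp only at this ⊢
  linarith

lemma exists_tendsto_energy (hs : IsPrimalDualTrajectory P M H G ξ ζ ρ x μ lam)
    (hP : P.StandingAssumption) {z : EuclideanSpace ℝ (Fin n) × (Fin r → ℝ) × (Fin m → ℝ)}
    (hz : z ∈ P.kktSet) : ∃ L, Tendsto (fun t => energy z (state ξ ζ ρ t)) atTop (𝓝 L) := by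
  have hanti : Antitone fun t => energy z (state ξ ζ ρ (max t 0)) := fun a b hab =>
    hs.energy_antitoneOn hP hz (mem_Ici.2 (le_max_right _ _)) (mem_Ici.2 (le_max_right _ _))
      (max_le_max_right 0 hab)
  refine ⟨_, (tendsto_atTop_ciInf hanti
    ⟨0, by rintro _ ⟨t, rfl⟩; exact energy_nonneg _ _⟩).congr' ?_⟩
  filter_upwards [eventually_ge_atTop 0] with t ht
  rw [max_eq_left ht]

lemma boundedOnNonneg_state (hs : IsPrimalDualTrajectory P M H G ξ ζ ρ x μ lam)
    (hP : P.StandingAssumption) (hKKT : P.kktSet.Nonempty) :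
    BoundedOnNonneg (state ξ ζ ρ) := by
  obtain ⟨z, hz⟩ := hKKT
  have hE : ∀ t, 0 ≤ t → energy z (state ξ ζ ρ t) ≤ energy z (state ξ ζ ρ 0) := fun t ht =>
    hs.energy_antitoneOn hP hz (self_mem_Ici) ht ht
  refine .prodMk (.pi fun i => .pi fun k => ?_)
    (.prodMk (.pi fun j => .pi fun q => ?_) (.pi fun l => .pi fun p => ?_))
  · exact (M i).boundedOnNonneg_of_storage_le
      (fun t ht => (primal_storage_le_energy z (state ξ ζ ρ t) i).trans (hE t ht)) k
  · exact (H j).boundedOnNonneg_of_storage_le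
      (fun t ht => (equality_storage_le_energy z (state ξ ζ ρ t) j).trans (hE t ht)) q
  · exact (G l).boundedOnNonneg_of_storage_le
      (fun t ht => (inequality_storage_le_energy z (state ξ ζ ρ t) l).trans (hE t ht)) p

lemma boundedOnNonneg_x (hs : IsPrimalDualTrajectory P M H G ξ ζ ρ x μ lam)
    (hP : P.StandingAssumption) (hKKT : P.kktSet.Nonempty) : BoundedOnNonneg x := by
  have hb := hs.boundedOnNonneg_state hP hKKT
  have hq : Continuous fun y : NetState M H G => ∑ i, (M i).d * y.inV P y.stateSum i ^ 2 := by
    have := (continuous_inV (M := M) (H := H) (G := G) hP).comp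
      (continuous_id.prodMk continuous_stateSum)
    have h2 := continuous_pi_iff.1 this
    exact continuous_finsetSum _ fun i _ => continuous_const.mul ((h2 i).pow 2)
  obtain ⟨C, hC⟩ := boundedOnNonneg_real.1 (hb.comp hq)
  refine BoundedOnNonneg.comp (f := fun t => (x t).ofLp) (.pi fun i => ?_)
    (PiLp.continuous_toLp 2 _)
  have hsi : Continuous fun y : NetState M H G => ∑ k, y.1 i k := by fun_prop
  obtain ⟨B, hB⟩ := boundedOnNonneg_real.1 (hb.comp hsi)
  refine boundedOnNonneg_real.2 ⟨B + ((M i).d * C + 1), fun t ht => ?_⟩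
  rw [hs.solvesLoop ht i]
  refine (abs_add_le _ _).trans (add_le_add (hB t ht) ?_)
  have h1 := (hs.solvesLoop ht).feedthrough_le hP (hs.state_nonneg ht) i
  have h2 := (le_abs_self _).trans (hC t ht)
  have h3 : ((M i).d * (state ξ ζ ρ t).inV P (x t) i) ^ 2 ≤ (M i).d * C := by
    have := mul_le_mul_of_nonneg_left (h1.trans h2) (M i).d_nonneg
    linarith
  nlinarith [sq_abs ((M i).d * (state ξ ζ ρ t).inV P (x t) i),
    sq_nonneg (|(M i).d * (state ξ ζ ρ t).inV P (x t) i| - 1)]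

lemma boundedOnNonneg_joint (hs : IsPrimalDualTrajectory P M H G ξ ζ ρ x μ lam)
    (hP : P.StandingAssumption) (hKKT : P.kktSet.Nonempty) :
    BoundedOnNonneg fun t => (state ξ ζ ρ t, x t) :=
  (hs.boundedOnNonneg_state hP hKKT).prodMk (hs.boundedOnNonneg_x hP hKKT)

lemma uniformContinuousOn_state (hs : IsPrimalDualTrajectory P M H G ξ ζ ρ x μ lam)
    (hP : P.StandingAssumption) (hKKT : P.kktSet.Nonempty) :
    UniformContinuousOn (state ξ ζ ρ) (Ici 0) := by
  have hb := hs.boundedOnNonneg_joint hP hKKT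
  have hV := continuous_pi_iff.1 (continuous_inV (M := M) (H := H) (G := G) hP)
  have hW := hP.continuous_signalW
  have hH := P.continuous_signalH
  refine uniformContinuousOn_prodMk
    (uniformContinuousOn_pi fun i => uniformContinuousOn_pi fun k => ?_)
    (uniformContinuousOn_prodMk
      (uniformContinuousOn_pi fun j => uniformContinuousOn_pi fun q => ?_)
      (uniformContinuousOn_pi fun l => uniformContinuousOn_pi fun p => ?_))
  · have hc : Continuous fun w : NetState M H G × EuclideanSpace ℝ (Fin n) =>
        -(M i).a k * w.1.1 i k + (M i).c k * w.1.inV P w.2 i := by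
      have := hV i
      fun_prop
    obtain ⟨C, hC⟩ := boundedOnNonneg_real.1 (hb.comp hc)
    exact uniformContinuousOn_of_ae_hasDerivAt_bounded (hs.ac_ξ i k)
      ((hs.hasDerivAt_ξ i k).mono fun t ht h0 => ⟨_, ht h0, hC t h0.le⟩)
  · have hc : Continuous fun w : NetState M H G × EuclideanSpace ℝ (Fin n) =>
        -(H j).a q * w.1.2.1 j q + (H j).c q * P.signalH w.2 j := by
      fun_prop
    obtain ⟨C, hC⟩ := boundedOnNonneg_real.1 (hb.comp hc)
    exact uniformContinuousOn_of_ae_hasDerivAt_bounded (hs.ac_ζ j q)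
      ((hs.deriv_ζ j q).mono fun t ht h0 => ⟨_, ht h0, hC t h0.le⟩)
  · have hc : Continuous fun w : NetState M H G × EuclideanSpace ℝ (Fin n) =>
        -(G l).a p * w.1.2.2 l p + (G l).c p * P.signalW w.2 l := by
      fun_prop
    obtain ⟨C, hC⟩ := boundedOnNonneg_real.1 (hb.comp hc)
    exact uniformContinuousOn_of_ae_hasDerivAt_bounded (hs.ac_ρ l p)
      ((hs.deriv_ρ l p).mono fun t ht h0 =>
        ⟨_, ht h0, (abs_posProj_le _ _).trans (hC t h0.le)⟩)

/-- By uniqueness of the solution of the algebraic loop, `x` inherits uniform continuity from the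
states. -/
lemma uniformContinuousOn_joint (hs : IsPrimalDualTrajectory P M H G ξ ζ ρ x μ lam)
    (hP : P.StandingAssumption) (hKKT : P.kktSet.Nonempty) :
    UniformContinuousOn (fun t => (state ξ ζ ρ t, x t)) (Ici 0) := by
  have hst := hs.uniformContinuousOn_state hP hKKT
  refine uniformContinuousOn_prodMk hst ?_
  exact hst.of_fst_determines (hs.boundedOnNonneg_joint hP hKKT) (isClosed_loopGraph hP)
    (fun _ hw _ hw' h => loopGraph_fst_determines hP hw hw' h)
    fun t ht => ⟨hs.state_nonneg ht, hs.solvesLoop ht⟩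

/-! ### Asymptotics of the signals -/

lemma tendsto_totalDissipation (hs : IsPrimalDualTrajectory P M H G ξ ζ ρ x μ lam)
    (hP : P.StandingAssumption) (hKKT : P.kktSet.Nonempty) :
    Tendsto (fun t => (state ξ ζ ρ t).totalDissipation P (x t)) atTop (𝓝 0) := by
  obtain ⟨z, hz⟩ := id hKKT
  obtain ⟨L, hL⟩ := hs.exists_tendsto_energy hP hz
  have huc := (hs.uniformContinuousOn_joint hP hKKT).comp_of_boundedOnNonneg
    (hs.boundedOnNonneg_joint hP hKKT) (continuous_totalDissipation hP)
  rw [Metric.tendsto_nhds]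
  intro ε hε
  filter_upwards [(hs.energy_derivGE hP hz).eventually_le_of_uniformContinuousOn hL.neg huc
    (half_pos hε)] with t ht
  rw [Real.dist_eq, sub_zero, abs_of_nonneg (totalDissipation_nonneg _ _)]
  linarith

lemma tendsto_ξ (hs : IsPrimalDualTrajectory P M H G ξ ζ ρ x μ lam)
    (hP : P.StandingAssumption) (hKKT : P.kktSet.Nonempty) (i : Fin n)
    {k : Fin ((M i).p + 1)} (hk : k ≠ 0) : Tendsto (ξ i k) atTop (𝓝 0) :=
  tendsto_zero_of_mul_sq_le (div_pos ((M i).a_pos hk) ((M i).c_pos k))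
    (fun t => by
      rw [div_mul_eq_mul_div]
      exact ((M i).lag_le_dissipation (fun k => ξ i k t) _ k).trans
        (primal_dissipation_le (state ξ ζ ρ t) (x t) i))
    (hs.tendsto_totalDissipation hP hKKT)

lemma tendsto_ζ (hs : IsPrimalDualTrajectory P M H G ξ ζ ρ x μ lam)
    (hP : P.StandingAssumption) (hKKT : P.kktSet.Nonempty) (j : Fin r)
    {q : Fin ((H j).p + 1)} (hq : q ≠ 0) : Tendsto (ζ j q) atTop (𝓝 0) :=
  tendsto_zero_of_mul_sq_le (div_pos ((H j).a_pos hq) ((H j).c_pos q))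
    (fun t => by
      rw [div_mul_eq_mul_div]
      exact ((H j).lag_le_dissipation (fun q => ζ j q t) _ q).trans
        (equality_dissipation_le (state ξ ζ ρ t) (x t) j))
    (hs.tendsto_totalDissipation hP hKKT)

lemma tendsto_ρ (hs : IsPrimalDualTrajectory P M H G ξ ζ ρ x μ lam)
    (hP : P.StandingAssumption) (hKKT : P.kktSet.Nonempty) (l : Fin m)
    {p : Fin ((G l).p + 1)} (hp : p ≠ 0) : Tendsto (ρ l p) atTop (𝓝 0) :=
  tendsto_zero_of_mul_sq_le (div_pos ((G l).a_pos hp) ((G l).c_pos p))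
    (fun t => by
      rw [div_mul_eq_mul_div]
      exact ((G l).lag_le_dissipation (fun p => ρ l p t) _ p).trans
        (inequality_dissipation_le (state ξ ζ ρ t) (x t) l))
    (hs.tendsto_totalDissipation hP hKKT)

/-- The stable zero makes `v` observable through the dissipation: either through a feedthrough
term, or through a lag, whose state and hence, by Barbalat's lemma, whose derivative vanishes at
infinity. -/
lemma tendsto_inV (hs : IsPrimalDualTrajectory P M H G ξ ζ ρ x μ lam)
    (hP : P.StandingAssumption) (hKKT : P.kktSet.Nonempty) (hM : ∀ i, (M i).HasStableZero)
    (i : Fin n) : Tendsto (fun t => (state ξ ζ ρ t).inV P (x t) i) atTop (𝓝 0) := by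
  rcases (hM i).exists_ne_zero_or_pos with ⟨k, hk⟩ | hd
  · have h0 := hs.tendsto_ξ hP hKKT i hk
    have hV := continuous_pi_iff.1 (continuous_inV (M := M) (H := H) (G := G) hP) i
    have hc : Continuous fun w : NetState M H G × EuclideanSpace ℝ (Fin n) =>
        -(M i).a k * w.1.1 i k + (M i).c k * w.1.inV P w.2 i := by
      fun_prop
    have h1 := tendsto_zero_of_hasDerivAt_of_uniformContinuousOn (hs.ac_ξ i k)
      (hs.hasDerivAt_ξ i k) h0 ((hs.uniformContinuousOn_joint hP hKKT).comp_of_boundedOnNonneg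
        (hs.boundedOnNonneg_joint hP hKKT) hc)
    have h2 := (h1.add (h0.const_mul ((M i).a k))).div_const ((M i).c k)
    rw [mul_zero, add_zero, zero_div] at h2
    refine h2.congr fun t => ?_
    have := ((M i).c_pos k).ne'
    field_simp
    ring
  · exact tendsto_zero_of_mul_sq_le hd
      (fun t => ((M i).feedthrough_le_dissipation _ _).trans
        (primal_dissipation_le (state ξ ζ ρ t) (x t) i))
      (hs.tendsto_totalDissipation hP hKKT)

lemma slowlyVarying_x (hs : IsPrimalDualTrajectory P M H G ξ ζ ρ x μ lam)
    (hP : P.StandingAssumption) (hKKT : P.kktSet.Nonempty) (hM : ∀ i, (M i).HasStableZero) :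
    SlowlyVarying x := by
  refine SlowlyVarying.euclidean fun i => ?_
  have hv := hs.tendsto_inV hP hKKT hM i
  have hξ : ∀ k, SlowlyVarying (ξ i k) := fun k => by
    refine .of_hasDerivAt (hs.ac_ξ i k) (hs.hasDerivAt_ξ i k) ?_
    have h1 : Tendsto (fun t => -(M i).a k * ξ i k t) atTop (𝓝 0) := by
      by_cases hk : k = 0
      · subst hk
        simp [(M i).a_zero]
      · simpa using (hs.tendsto_ξ hP hKKT i hk).const_mul (-(M i).a k)
    simpa using h1.add (hv.const_mul ((M i).c k))
  have h2 : SlowlyVarying fun t => (M i).d * (state ξ ζ ρ t).inV P (x t) i :=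
    .of_tendsto (hv.const_mul _)
  exact ((SlowlyVarying.sum (S := Finset.univ) fun k _ => hξ k).add h2).congr
    fun t ht => (hs.solvesLoop ht i).symm

lemma tendsto_signalH (hs : IsPrimalDualTrajectory P M H G ξ ζ ρ x μ lam)
    (hP : P.StandingAssumption) (hKKT : P.kktSet.Nonempty) (hM : ∀ i, (M i).HasStableZero)
    (j : Fin r) : Tendsto (fun t => P.signalH (x t) j) atTop (𝓝 0) := by
  have hc : ∀ c : ℝ, Continuous fun x => c * P.signalH x j := fun c => by
    have := P.continuous_signalH
    fun_prop
  have hsv := fun c => (hs.slowlyVarying_x hP hKKT hM).comp (hs.boundedOnNonneg_x hP hKKT) (hc c)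
  have hb := hs.boundedOnNonneg_state hP hKKT
  have hb1 : BoundedOnNonneg (ζ j 0) :=
    hb.comp (g := fun y : NetState M H G => y.2.1 j 0) (by fun_prop)
  have hb2 : BoundedOnNonneg fun t => -ζ j 0 t :=
    hb.comp (g := fun y : NetState M H G => -y.2.1 j 0) (by fun_prop)
  have hd : ∀ᵐ t : ℝ, 0 < t → HasDerivAt (ζ j 0) ((H j).c 0 * P.signalH (x t) j) t := by
    filter_upwards [hs.deriv_ζ j 0] with t ht h0
    simpa [(H j).a_zero] using ht h0
  have hpos := (H j).c_pos 0
  rw [Metric.tendsto_nhds]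
  intro ε hε
  have hε' : 0 < (H j).c 0 * (ε / 2) := by positivity
  have hneg : SlowlyVarying fun t => -((H j).c 0 * P.signalH (x t) j) := by
    simpa using hsv (-(H j).c 0)
  filter_upwards [(DerivGE.of_hasDerivAt (hs.ac_ζ j 0) hd).eventually_le_of_slowlyVarying hb1
      (hsv _) hε',
    (DerivGE.neg_of_hasDerivAt (hs.ac_ζ j 0) hd).eventually_le_of_slowlyVarying hb2
      hneg hε'] with t h1 h2
  rw [← mul_neg] at h2
  have h3 := le_of_mul_le_mul_left h1 hpos
  have h4 := le_of_mul_le_mul_left h2 hpos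
  rw [Real.dist_eq, sub_zero, abs_lt]
  constructor <;> linarith

lemma slowlyVarying_signalW (hs : IsPrimalDualTrajectory P M H G ξ ζ ρ x μ lam)
    (hP : P.StandingAssumption) (hKKT : P.kktSet.Nonempty) (hM : ∀ i, (M i).HasStableZero)
    (l : Fin m) (c : ℝ) : SlowlyVarying fun t => c * P.signalW (x t) l := by
  have := hP.continuous_signalW
  exact (hs.slowlyVarying_x hP hKKT hM).comp (hs.boundedOnNonneg_x hP hKKT)
    (g := fun x => c * P.signalW x l) (by fun_prop)

lemma boundedOnNonneg_ρ (hs : IsPrimalDualTrajectory P M H G ξ ζ ρ x μ lam)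
    (hP : P.StandingAssumption) (hKKT : P.kktSet.Nonempty) (l : Fin m)
    (p : Fin ((G l).p + 1)) : BoundedOnNonneg (ρ l p) :=
  (hs.boundedOnNonneg_state hP hKKT).comp (g := fun y : NetState M H G => y.2.2 l p)
    (by fun_prop)

lemma derivGE_ρ (hs : IsPrimalDualTrajectory P M H G ξ ζ ρ x μ lam) (l : Fin m) :
    DerivGE (ρ l 0) (fun t => (G l).c 0 * P.signalW (x t) l) := by
  refine ⟨hs.ac_ρ l 0, ?_⟩
  filter_upwards [hs.deriv_ρ l 0] with t ht h0
  refine ⟨_, ht h0, ?_⟩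
  rw [(G l).a_zero, neg_zero, zero_mul, zero_add]
  exact self_le_posProj _ _

lemma eventually_signalW_le (hs : IsPrimalDualTrajectory P M H G ξ ζ ρ x μ lam)
    (hP : P.StandingAssumption) (hKKT : P.kktSet.Nonempty) (hM : ∀ i, (M i).HasStableZero)
    (l : Fin m) {ε : ℝ} (hε : 0 < ε) : ∀ᶠ t in atTop, P.signalW (x t) l ≤ ε := by
  have hpos := (G l).c_pos 0
  filter_upwards [(hs.derivGE_ρ l).eventually_le_of_slowlyVarying (hs.boundedOnNonneg_ρ hP hKKT l 0)
    (hs.slowlyVarying_signalW hP hKKT hM l _) (mul_pos hpos hε)] with t ht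
  exact le_of_mul_le_mul_left ht hpos

lemma tendsto_max_signalW (hs : IsPrimalDualTrajectory P M H G ξ ζ ρ x μ lam)
    (hP : P.StandingAssumption) (hKKT : P.kktSet.Nonempty) (hM : ∀ i, (M i).HasStableZero)
    (l : Fin m) : Tendsto (fun t => max 0 (P.signalW (x t) l)) atTop (𝓝 0) := by
  rw [Metric.tendsto_nhds]
  intro ε hε
  filter_upwards [hs.eventually_signalW_le hP hKKT hM l (half_pos hε)] with t ht
  rw [Real.dist_eq, sub_zero, abs_of_nonneg (le_max_left _ _)]
  exact max_lt hε (by linarith)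

/-- While `w < 0`, the integrator state `ρ l 0` is nonincreasing, and before a time at which it is
positive it decreases at rate `c w`. -/
lemma le_ρ_sub (hs : IsPrimalDualTrajectory P M H G ξ ζ ρ x μ lam) (l : Fin m) {a b K : ℝ}
    (ha : 0 ≤ a) (hab : a ≤ b) (hK : 0 ≤ K) (hpos : 0 < ρ l 0 b)
    (hw : ∀ t ∈ Icc a b, P.signalW (x t) l ≤ -K) :
    (G l).c 0 * K * (b - a) ≤ ρ l 0 a - ρ l 0 b := by
  have hc := (G l).c_pos 0
  have hsig : ∀ t ∈ Icc a b, (G l).c 0 * P.signalW (x t) l ≤ -((G l).c 0 * K) := fun t ht => by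
    rw [← mul_neg]
    exact mul_le_mul_of_nonneg_left (hw t ht) hc.le
  have hneg : ∀ T, 0 ≤ T → AbsolutelyContinuousOnInterval (fun t => -ρ l 0 t) 0 T :=
    fun T hT => (hs.ac_ρ l 0 T hT).neg
  have hd0 : ∀ᵐ t : ℝ, 0 < t → HasDerivAt (fun t => -ρ l 0 t)
      (-posProj ((G l).c 0 * P.signalW (x t) l) (ρ l 0 t)) t := by
    filter_upwards [hs.deriv_ρ l 0] with t ht h0
    have h := (ht h0).fun_neg
    rwa [(G l).a_zero, neg_zero, zero_mul, zero_add] at h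
  have hD := DerivGE.of_hasDerivAt hneg hd0
  have hmono : ∀ s ∈ Icc a b, 0 < ρ l 0 s := fun s hs' => by
    have h := hD.mul_le_sub (K := 0) (ha.trans hs'.1) hs'.2 fun t ht => by
      have h1 := hsig t ⟨hs'.1.trans ht.1.le, ht.2.le⟩
      have h2 : 0 ≤ (G l).c 0 * K := by positivity
      unfold posProj
      split_ifs <;> linarith
    linarith
  have h := hD.mul_le_sub (K := (G l).c 0 * K) ha hab fun t ht => by
    have ht' : t ∈ Icc a b := ⟨ht.1.le, ht.2.le⟩
    have h1 := hsig t ht'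
    unfold posProj
    rw [if_neg (fun h => (hmono t ht').ne' h.1)]
    linarith
  linarith

/-- Asymptotic complementary slackness. If `ρ l 0` and `-w` were both bounded away from `0` at a
late time `t`, then, as `w` varies slowly, `ρ l 0` would have decreased at a definite rate over a
long window before `t`, which contradicts its boundedness. -/
lemma tendsto_ρ_mul_signalW (hs : IsPrimalDualTrajectory P M H G ξ ζ ρ x μ lam)
    (hP : P.StandingAssumption) (hKKT : P.kktSet.Nonempty) (hM : ∀ i, (M i).HasStableZero)
    (l : Fin m) : Tendsto (fun t => ρ l 0 t * P.signalW (x t) l) atTop (𝓝 0) := by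
  obtain ⟨B, hB⟩ := boundedOnNonneg_real.1 (hs.boundedOnNonneg_ρ hP hKKT l 0)
  have hB0 : 0 ≤ B := (abs_nonneg _).trans (hB 0 le_rfl)
  have hc := (G l).c_pos 0
  rw [Metric.tendsto_nhds]
  intro ε hε
  have hη : 0 < ε / (B + 1) := by positivity
  set η := ε / (B + 1) with hη_def
  have hBη : B * η < ε := by
    rw [hη_def, mul_div_assoc', div_lt_iff₀ (by positivity)]
    linarith
  -- Over a window of this length a decrease at rate `c 0 * (η / 2)` exceeds the bound `B`.
  set T := (B + 1) / ((G l).c 0 * (η / 2)) with hT_def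
  have hT : 0 < T := by positivity
  have hT' : (G l).c 0 * (η / 2) * T = B + 1 := by
    rw [hT_def]; field_simp
  have hsv := hs.slowlyVarying_signalW hP hKKT hM l 1 T (η / 4) (by positivity)
  simp only [one_mul] at hsv
  have hshift : Tendsto (fun t : ℝ => t - T) atTop atTop :=
    tendsto_atTop_add_const_right _ _ tendsto_id
  filter_upwards [hshift.eventually hsv, hshift.eventually (eventually_ge_atTop 0),
    hs.eventually_signalW_le hP hKKT hM l hη] with t h1 h2 h3
  rw [sub_add_cancel] at h1
  have ht0 : 0 ≤ t := by linarith
  have hρ := hs.ρ_nonneg l 0 t ht0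
  have hρB := (le_abs_self _).trans (hB t ht0)
  rw [Real.dist_eq, sub_zero, abs_lt]
  refine ⟨?_, ?_⟩
  · by_contra! hlt
    have hρpos : 0 < ρ l 0 t := by
      rcases hρ.eq_or_lt with h | h
      · rw [← h] at hlt; linarith
      · exact h
    have hwt : P.signalW (x t) l < -η := by
      by_contra! hw
      have : ρ l 0 t * -η ≤ ρ l 0 t * P.signalW (x t) l := mul_le_mul_of_nonneg_left hw hρ
      have : ρ l 0 t * η ≤ B * η := mul_le_mul_of_nonneg_right hρB hη.le
      linarith
    have hdec := hs.le_ρ_sub l (K := η / 2) h2 (by linarith : t - T ≤ t) (by positivity) hρpos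
      fun s hs' => by
        have e1 := abs_le.1 (h1 s hs')
        have e2 := abs_le.1 (h1 t ⟨by linarith, le_rfl⟩)
        linarith [e1.2, e2.1]
    rw [sub_sub_cancel, hT'] at hdec
    linarith [(le_abs_self _).trans (hB (t - T) h2)]
  · calc ρ l 0 t * P.signalW (x t) l ≤ ρ l 0 t * η := mul_le_mul_of_nonneg_left h3 hρ
      _ ≤ B * η := mul_le_mul_of_nonneg_right hρB hη.le
      _ < ε := hBη

end IsPrimalDualTrajectory

/-! ### Limit points and convergence -/

namespace IsPrimalDualTrajectory

variable {n r m : ℕ} {P : ConvexProgram n r m} {M : Fin n → Channel} {H : Fin r → Channel}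
  {G : Fin m → Channel} {ξ : (i : Fin n) → Fin ((M i).p + 1) → ℝ → ℝ}
  {ζ : (j : Fin r) → Fin ((H j).p + 1) → ℝ → ℝ} {ρ : (l : Fin m) → Fin ((G l).p + 1) → ℝ → ℝ}
  {x : ℝ → EuclideanSpace ℝ (Fin n)} {μ : ℝ → Fin r → ℝ} {lam : ℝ → Fin m → ℝ}

open NetState

/-- Along some sequence of times the trajectory approaches the equilibrium of a KKT point, relative
to which the energy therefore becomes arbitrarily small. -/
lemma exists_kkt_energy_limit (hs : IsPrimalDualTrajectory P M H G ξ ζ ρ x μ lam)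
    (hP : P.StandingAssumption) (hKKT : P.kktSet.Nonempty) (hM : ∀ i, (M i).HasStableZero) :
    ∃ z ∈ P.kktSet, ∃ τ : ℕ → ℝ, Tendsto τ atTop atTop ∧
      Tendsto (fun N => energy z (state ξ ζ ρ (τ N))) atTop (𝓝 0) := by
  obtain ⟨⟨y, x₀⟩, -, φ, hφ, hlim⟩ := tendsto_subseq_of_bounded
    (hs.boundedOnNonneg_joint hP hKKT) (x := fun N : ℕ => (state ξ ζ ρ N, x N))
    fun N => ⟨N, mem_Ici.2 N.cast_nonneg, rfl⟩
  have hτ : Tendsto (fun N => (φ N : ℝ)) atTop atTop :=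
    tendsto_natCast_atTop_atTop.comp hφ.tendsto_atTop
  -- A continuous function that vanishes asymptotically along the trajectory vanishes at `(y, x₀)`.
  have key : ∀ F : NetState M H G × EuclideanSpace ℝ (Fin n) → ℝ, Continuous F →
      Tendsto (fun t => F (state ξ ζ ρ t, x t)) atTop (𝓝 0) → F (y, x₀) = 0 := fun F hF h =>
    tendsto_nhds_unique ((hF.tendsto _).comp hlim) (h.comp hτ)
  have hcW := hP.continuous_signalW
  have hcH := P.continuous_signalH
  have hcV := continuous_pi_iff.1 (continuous_inV (M := M) (H := H) (G := G) hP)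
  have hξ : ∀ i k, k ≠ 0 → y.1 i k = 0 := fun i k hk =>
    key (fun w => w.1.1 i k) (by fun_prop) (hs.tendsto_ξ hP hKKT i hk)
  have hζ : ∀ j q, q ≠ 0 → y.2.1 j q = 0 := fun j q hq =>
    key (fun w => w.1.2.1 j q) (by fun_prop) (hs.tendsto_ζ hP hKKT j hq)
  have hρ : ∀ l p, p ≠ 0 → y.2.2 l p = 0 := fun l p hp =>
    key (fun w => w.1.2.2 l p) (by fun_prop) (hs.tendsto_ρ hP hKKT l hp)
  have hv : ∀ i, y.inV P x₀ i = 0 := fun i =>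
    key (fun w => w.1.inV P w.2 i) (hcV i) (hs.tendsto_inV hP hKKT hM i)
  have hh : ∀ j, P.signalH x₀ j = 0 := fun j =>
    key (fun w => P.signalH w.2 j) (by fun_prop) (hs.tendsto_signalH hP hKKT hM j)
  have hw : ∀ l, max 0 (P.signalW x₀ l) = 0 := fun l =>
    key (fun w => max 0 (P.signalW w.2 l)) (by fun_prop) (hs.tendsto_max_signalW hP hKKT hM l)
  have hcs : ∀ l, y.2.2 l 0 * P.signalW x₀ l = 0 := fun l =>
    key (fun w => w.1.2.2 l 0 * P.signalW w.2 l) (by fun_prop)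
      (hs.tendsto_ρ_mul_signalW hP hKKT hM l)
  have hmem : (y, x₀) ∈ loopGraph P M H G := (isClosed_loopGraph hP).mem_of_tendsto hlim
    (Eventually.of_forall fun N => ⟨hs.state_nonneg (φ N).cast_nonneg,
      hs.solvesLoop (φ N).cast_nonneg⟩)
  have hx : ∀ i, y.1 i 0 = x₀ i := fun i => by
    rw [hmem.2 i, hv i, mul_zero, add_zero, Finset.sum_eq_single 0 (fun k _ hk => hξ i k hk)
      (by simp)]
  have hμ : y.outMu P x₀ = fun j => y.2.1 j 0 := funext fun j => by
    rw [outMu, hh j, mul_zero, add_zero, Finset.sum_eq_single 0 (fun q _ hq => hζ j q hq)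
      (by simp)]
  have hlam : y.outLam P x₀ = fun l => y.2.2 l 0 := funext fun l => by
    rw [outLam, hw l, mul_zero, add_zero, Finset.sum_eq_single 0 (fun p _ hp => hρ l p hp)
      (by simp)]
  refine ⟨(x₀, fun j => y.2.1 j 0, fun l => y.2.2 l 0), ConvexProgram.mem_kktSet_iff.2
    ⟨fun i => ?_, hh, fun l => hmem.1 l 0, fun l => max_eq_left_iff.1 (hw l), hcs⟩, _, hτ, ?_⟩
  · simpa only [inV, hμ, hlam] using hv i
  · have h0 : energy (x₀, fun j => y.2.1 j 0, fun l => y.2.2 l 0) y = 0 := by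
      have e1 : ∀ i k, y.1 i k - (if k = 0 then x₀ i else 0) = 0 := fun i k => by
        split_ifs with hk
        · rw [hk, hx, sub_self]
        · rw [hξ i k hk, sub_self]
      have e2 : ∀ j q, y.2.1 j q - (if q = 0 then y.2.1 j 0 else 0) = 0 := fun j q => by
        split_ifs with hq
        · rw [hq, sub_self]
        · rw [hζ j q hq, sub_self]
      have e3 : ∀ l p, y.2.2 l p - (if p = 0 then y.2.2 l 0 else 0) = 0 := fun l p => by
        split_ifs with hp
        · rw [hp, sub_self]
        · rw [hρ l p hp, sub_self]
      simp [energy, Channel.storage, e1, e2, e3]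
    have := ((continuous_energy (M := M) (H := H) (G := G)
      (x₀, fun j => y.2.1 j 0, fun l => y.2.2 l 0)).tendsto y).comp
        ((continuous_fst.tendsto (y, x₀)).comp hlim)
    rw [h0] at this
    exact this

/-- If the energy relative to `z` vanishes at infinity, the outputs converge to `z`. -/
lemma tendsto_of_tendsto_energy (hs : IsPrimalDualTrajectory P M H G ξ ζ ρ x μ lam)
    (hP : P.StandingAssumption) (hKKT : P.kktSet.Nonempty) (hM : ∀ i, (M i).HasStableZero)
    {z : EuclideanSpace ℝ (Fin n) × (Fin r → ℝ) × (Fin m → ℝ)}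
    (h : Tendsto (fun t => energy z (state ξ ζ ρ t)) atTop (𝓝 0)) :
    Tendsto (fun t => (x t, μ t, lam t)) atTop (𝓝 z) := by
  have hξ : ∀ i k, Tendsto (ξ i k) atTop (𝓝 (if k = 0 then z.1 i else 0)) := fun i k =>
    (M i).tendsto_of_tendsto_storage (squeeze_zero (fun t => (M i).storage_nonneg _ _)
      (fun t => primal_storage_le_energy z (state ξ ζ ρ t) i) h) k
  have hζ : ∀ j q, Tendsto (ζ j q) atTop (𝓝 (if q = 0 then z.2.1 j else 0)) := fun j q =>
    (H j).tendsto_of_tendsto_storage (squeeze_zero (fun t => (H j).storage_nonneg _ _)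
      (fun t => equality_storage_le_energy z (state ξ ζ ρ t) j) h) q
  have hρ : ∀ l p, Tendsto (ρ l p) atTop (𝓝 (if p = 0 then z.2.2 l else 0)) := fun l p =>
    (G l).tendsto_of_tendsto_storage (squeeze_zero (fun t => (G l).storage_nonneg _ _)
      (fun t => inequality_storage_le_energy z (state ξ ζ ρ t) l) h) p
  refine Tendsto.prodMk_nhds ?_ (Tendsto.prodMk_nhds ?_ ?_)
  · have hx : Tendsto (fun t => (x t).ofLp) atTop (𝓝 z.1.ofLp) := by
      refine tendsto_pi_nhds.2 fun i => ?_
      have h1 := (tendsto_finsetSum Finset.univ fun k _ => hξ i k).add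
        ((hs.tendsto_inV hP hKKT hM i).const_mul (M i).d)
      simp only [Finset.sum_ite_eq', Finset.mem_univ, if_true, mul_zero, add_zero] at h1
      refine h1.congr' ?_
      filter_upwards [eventually_ge_atTop 0] with t ht
      exact (hs.solvesLoop ht i).symm
    exact ((PiLp.continuous_toLp 2 _).tendsto _).comp hx
  · refine tendsto_pi_nhds.2 fun j => ?_
    have h1 := (tendsto_finsetSum Finset.univ fun q _ => hζ j q).add
      ((hs.tendsto_signalH hP hKKT hM j).const_mul (H j).d)
    simp only [Finset.sum_ite_eq', Finset.mem_univ, if_true, mul_zero, add_zero] at h1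
    refine h1.congr' ?_
    filter_upwards [eventually_ge_atTop 0] with t ht
    exact (hs.output_μ t ht j).symm
  · refine tendsto_pi_nhds.2 fun l => ?_
    have h1 := (tendsto_finsetSum Finset.univ fun p _ => hρ l p).add
      ((hs.tendsto_max_signalW hP hKKT hM l).const_mul (G l).d)
    simp only [Finset.sum_ite_eq', Finset.mem_univ, if_true, mul_zero, add_zero] at h1
    refine h1.congr' ?_
    filter_upwards [eventually_ge_atTop 0] with t ht
    exact (hs.output_lam t ht l).symm

end IsPrimalDualTrajectory

theorem theorem1 {n r m : ℕ} (P : ConvexProgram n r m)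
    (M : Fin n → Channel) (H : Fin r → Channel) (G : Fin m → Channel)
    (hP : P.StandingAssumption) (hKKT : P.kktSet.Nonempty)
    (hM : ∀ i, (M i).HasStableZero)
    (ξ : (i : Fin n) → Fin ((M i).p + 1) → ℝ → ℝ)
    (ζ : (j : Fin r) → Fin ((H j).p + 1) → ℝ → ℝ)
    (ρ : (l : Fin m) → Fin ((G l).p + 1) → ℝ → ℝ)
    (x : ℝ → EuclideanSpace ℝ (Fin n)) (μ : ℝ → Fin r → ℝ) (lam : ℝ → Fin m → ℝ)
    (hsol : IsPrimalDualTrajectory P M H G ξ ζ ρ x μ lam) :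
    ∃ z ∈ P.kktSet,
      Filter.Tendsto (fun t => (x t, μ t, lam t)) Filter.atTop (nhds z) := by
  obtain ⟨z, hz, τ, hτ, hlim⟩ := hsol.exists_kkt_energy_limit hP hKKT hM
  obtain ⟨L, hL⟩ := hsol.exists_tendsto_energy hP hz
  have hL0 : L = 0 := tendsto_nhds_unique (hL.comp hτ) hlim
  rw [hL0] at hL
  exact ⟨z, hz, hsol.tendsto_of_tendsto_energy hP hKKT hM hL⟩
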